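/- Let $r\in(0,1]$ and let $f:[0,\infty)\to(0,1/2]$ be a continuous, strictly decreasing function such that (i) $f(x)\to 0$ as $x\to\infty$; (ii) for every $u\in(0,1)$, $u^x=o(f(x))$ as $x\to\infty$; and (iii) $x\mapsto\log f(x)$ is convex on $[0,\infty)$. Then, on some probability space $(\Omega,\mathcal F,P)$, there exists a strictly stationary, real-valued Markov chain $X=(X_k)_{k\in\mathbb Z}$ with a countable (finite or countably infinite) state space which is reversible, i.e. $(X_{-k})_{k\in\mathbb Z}$ has the same law on $\mathbb R^{\mathbb Z}$ as $X$, and such that for every integer $n\ge 1$ $$\rho_X(n)=r^n\qquad\text{and}\qquad \tfrac12\, r^n f(n)\le \alpha_X(n)\le\beta_X(n)\le 12\, r^n f(n).$$ Here, for $\kappa\in\{\alpha,\beta,\rho\}$, $\kappa_X(n)=\kappa\bigl(\sigma(X_k,k\le 0),\,\sigma(X_k,k\ge n)\bigr)$, where for $\sigma$-fields $\mathcal A,\mathcal B\subset\mathcal F$ $$\alpha(\mathcal A,\mathcal B)=\sup_{A\in\mathcal A,\,B\in\mathcal B}|P(A\cap B)-P(A)P(B)|,\qquad \beta(\mathcal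 A,\mathcal B)=\sup\tfrac12\sum_{i=1}^I\sum_{j=1}^J|P(A_i\cap B_j)-P(A_i)P(B_j)|,$$ the latter supremum being over all pairs of finite partitions $\{A_1,\dots,A_I\}$, $\{B_1,\dots,B_J\}$ of $\Omega$ with $A_i\in\mathcal A$ and $B_j\in\mathcal B$, and $\rho(\mathcal A,\mathcal B)=\sup|\mathrm{Corr}(Y,Z)|$ over all square-integrable random variables $Y$, $Z$ such that $Y$ is $\mathcal A$-measurable and $Z$ is $\mathcal B$-measurable (with $\mathrm{Corr}(Y,Z)=0$ if $Y$ or $Z$ has variance $0$). -/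

import Mathlib

open MeasureTheory ProbabilityTheory Filter Topology Asymptotics

namespace MixingRates

noncomputable section

/-! Measures of dependence between two sub-σ-fields `𝒜` and `ℬ` of a probability space. The sets
whose suprema are taken below are nonempty and bounded by `1` whenever `P` is a probability
measure. -/

/-- `α(𝒜, ℬ) = sup |P(A ∩ B) - P(A) P(B)|` over `A ∈ 𝒜`, `B ∈ ℬ`. -/
def alphaCoeff {Ω : Type*} {_ : MeasurableSpace Ω} (P : Measure Ω) (𝒜 ℬ : MeasurableSpace Ω) : ℝ :=
  sSup {x : ℝ | ∃ A B : Set Ω, MeasurableSet[𝒜] A ∧ MeasurableSet[ℬ] B ∧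
    x = |P.real (A ∩ B) - P.real A * P.real B|}

/-- A finite family of `𝒜`-measurable, pairwise disjoint sets which cover `Ω`. Empty members are
allowed; they contribute nothing to the sums in `betaCoeff`. -/
structure IsFinPartition {Ω : Type*} (𝒜 : MeasurableSpace Ω) {I : ℕ} (A : Fin I → Set Ω) :
    Prop where
  measurableSet : ∀ i, MeasurableSet[𝒜] (A i)
  disjoint : Pairwise fun i j => Disjoint (A i) (A j)
  iUnion_eq : ⋃ i, A i = Set.univ

/-- `β(𝒜, ℬ) = sup (1/2) ∑ᵢ ∑ⱼ |P(Aᵢ ∩ Bⱼ) - P(Aᵢ) P(Bⱼ)|` over all pairs of finite partitions of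
`Ω`, the first into sets of `𝒜`, the second into sets of `ℬ`. -/
def betaCoeff {Ω : Type*} {_ : MeasurableSpace Ω} (P : Measure Ω) (𝒜 ℬ : MeasurableSpace Ω) : ℝ :=
  sSup {x : ℝ | ∃ (I J : ℕ) (A : Fin I → Set Ω) (B : Fin J → Set Ω),
    IsFinPartition 𝒜 A ∧ IsFinPartition ℬ B ∧
    x = (1 / 2) * ∑ i, ∑ j, |P.real (A i ∩ B j) - P.real (A i) * P.real (B j)|}

/-- The correlation of two square-integrable random variables, equal to `0` if one of them has
variance `0`. -/
def corr {Ω : Type*} {_ : MeasurableSpace Ω} (P : Measure Ω) (Y Z : Ω → ℝ) : ℝ :=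
  cov[Y, Z; P] / (√Var[Y; P] * √Var[Z; P])

/-- The maximal correlation coefficient `ρ(𝒜, ℬ) = sup |Corr(Y, Z)|` over all square-integrable
`Y`, `Z` such that `Y` is `𝒜`-measurable and `Z` is `ℬ`-measurable. -/
def rhoCoeff {Ω : Type*} {_ : MeasurableSpace Ω} (P : Measure Ω) (𝒜 ℬ : MeasurableSpace Ω) : ℝ :=
  sSup {x : ℝ | ∃ Y Z : Ω → ℝ, Measurable[𝒜] Y ∧ Measurable[ℬ] Z ∧
    MemLp Y 2 P ∧ MemLp Z 2 P ∧ x = |corr P Y Z|}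

/-- The σ-field generated by `X k`, `k ≤ j`. -/
abbrev past {Ω : Type*} (X : ℤ → Ω → ℝ) (j : ℤ) : MeasurableSpace Ω :=
  ⨆ k : ℤ, ⨆ _ : k ≤ j, MeasurableSpace.comap (X k) Real.measurableSpace

/-- The σ-field generated by `X k`, `k ≥ j`. -/
abbrev future {Ω : Type*} (X : ℤ → Ω → ℝ) (j : ℤ) : MeasurableSpace Ω :=
  ⨆ k : ℤ, ⨆ _ : j ≤ k, MeasurableSpace.comap (X k) Real.measurableSpace

/-- `α_X(n)`. -/
def alphaMix {Ω : Type*} {_ : MeasurableSpace Ω} (P : Measure Ω) (X : ℤ → Ω → ℝ) (n : ℕ) : ℝ :=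
  alphaCoeff P (past X 0) (future X n)

/-- `β_X(n)`. -/
def betaMix {Ω : Type*} {_ : MeasurableSpace Ω} (P : Measure Ω) (X : ℤ → Ω → ℝ) (n : ℕ) : ℝ :=
  betaCoeff P (past X 0) (future X n)

/-- `ρ_X(n)`. -/
def rhoMix {Ω : Type*} {_ : MeasurableSpace Ω} (P : Measure Ω) (X : ℤ → Ω → ℝ) (n : ℕ) : ℝ :=
  rhoCoeff P (past X 0) (future X n)

/-- Strict stationarity: the law on `ℝ^ℤ` of the sequence is invariant under all shifts. -/
def IsStrictlyStationary {Ω : Type*} {_ : MeasurableSpace Ω} (P : Measure Ω) (X : ℤ → Ω → ℝ) : Prop :=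
  ∀ m : ℤ, P.map (fun ω (k : ℤ) => X (k + m) ω) = P.map (fun ω (k : ℤ) => X k ω)

/-- The Markov property: given the past up to time `k`, the conditional law of `X (k + 1)` depends
on `X k` only. -/
def IsMarkovChain {Ω : Type*} {_ : MeasurableSpace Ω} (P : Measure Ω) (X : ℤ → Ω → ℝ) : Prop :=
  ∀ (k : ℤ) (B : Set ℝ), MeasurableSet B →
    P⟦X (k + 1) ⁻¹' B | past X k⟧ =ᵐ[P]
      P⟦X (k + 1) ⁻¹' B | MeasurableSpace.comap (X k) Real.measurableSpace⟧

/-- Reversibility: the sequence and its time reversal have the same law on `ℝ^ℤ`. -/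
def IsReversible {Ω : Type*} {_ : MeasurableSpace Ω} (P : Measure Ω) (X : ℤ → Ω → ℝ) : Prop :=
  P.map (fun ω (k : ℤ) => X (-k) ω) = P.map (fun ω (k : ℤ) => X k ω)

/-- All the random variables take their values in one countable (finite or countably infinite)
set of states. -/
def IsCountableState {Ω : Type*} (X : ℤ → Ω → ℝ) : Prop :=
  ∃ S : Set ℝ, S.Countable ∧ ∀ k ω, X k ω ∈ S

end

end MixingRates

/-!
The chain lives on `ℕ` and its transition kernel is written down through its spectral decomposition.
Let `w` be a law on `ℕ` of full support with distribution function `G`, and let `φ (l + 1)` be the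
normalized contrast of the state `l + 1` with the block `{0, …, l}`; together with `φ 0 = 1` these
functions are orthonormal in `L²(w)`. If `lam 0 = 1` and `lam 1 ≤ lam 2 ≤ ⋯ ≤ 1`, the kernel
`q s t = w t * ∑ i, lam i * φ i s * φ i t` is nonnegative (`IsFullCdf.contrast_kernel_nonneg`, a
telescoping estimate), and it is then a reversible transition kernel with stationary law `w`.

For the two-sided stationary chain with this kernel, the joint law of a past event `A` and an event
`B` of the future from time `n` on is diagonal in the contrasts
(`IsSpectralSystem.hasSum_real_inter`):
`P(A ∩ B) = ∑ i, lam i ^ n * E[1_A φ_i(X_0)] * E[1_B φ_i(X_n)]`.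
All the dependence coefficients are read off from this expansion.
* Bessel's inequality bounds every correlation by `(sup_{i ≥ 1} lam i) ^ n`.
* The triangle inequality bounds `β` by half of `∑_{i ≥ 1} lam i ^ n * ‖φ i‖₁ ^ 2`, and
  `‖φ (l + 1)‖₁ ^ 2 ≤ 4 * G l * (1 - G l)`.
* The tail events `{X_0 > j}` and `{X_n > j}` have covariance at least
  `lam (j + 1) ^ n * G j * (1 - G j)`, which bounds `α` and `ρ` from below
  (`IsFullCdf.le_real_tail_inter`).

So with `lam (j + 1) = r * u j` and `G j * (1 - G j) = C j / 2`, it remains to find weights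
`C j ≤ 1 / 2` decreasing to `0` and rates `u j < 1` increasing to `1` such that
`sup_j C j * u j ^ n ≥ f n` and `∑ j, C j * u j ^ n ≤ 8 * f n`
(`exists_exponential_envelope`). They are the exponentials of chords of the convex function `log f`,
whose breakpoints are chosen greedily: each chord is as long as possible among those that exceed
`log f` by at most `log 2` at the integers. The chords then cover `log f` from above, while at a
given integer they fall off geometrically on both sides. That the slopes tend to `0` is the
assumption that `f` decays more slowly than every exponential.

The two-sided chain is built from independent jump instructions, run from a stationary state at time
`0` forwards and backwards in time; reversibility makes the probabilities of paths over windows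
independent of the position of the origin. These probabilities determine the law, which gives
stationarity and reversibility, and yield the conditional independence of past and future given the
present by a π-λ argument.
-/

namespace MixingRates

open scoped ENNReal InnerProductSpace

/-! ### Envelopes of log-convex functions by exponentials -/

/-- The affine function whose graph is the chord of `g` over `[a, b]`. -/
noncomputable def chord (g : ℝ → ℝ) (a b x : ℝ) : ℝ := g a + slope g a b * (x - a)

theorem slope_le_slope_of_convexOn {g : ℝ → ℝ} {S : Set ℝ} (hg : ConvexOn ℝ S g)
    {a b c d : ℝ} (ha : a ∈ S) (hb : b ∈ S) (hc : c ∈ S) (hd : d ∈ S)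
    (hab : a < b) (hcd : c < d) (hac : a ≤ c) (hbd : b ≤ d) : slope g a b ≤ slope g c d := by
  have h1 : slope g a b ≤ slope g a d :=
    hg.slope_mono ha ⟨hb, by simpa using hab.ne'⟩ ⟨hd, by simpa using (hab.trans_le hbd).ne'⟩ hbd
  have h2 : slope g d a ≤ slope g d c :=
    hg.slope_mono hd ⟨ha, by simpa using (hab.trans_le hbd).ne⟩ ⟨hc, by simpa using hcd.ne⟩ hac
  rw [slope_comm g d a, slope_comm g d c] at h2
  exact h1.trans h2

theorem eq_add_slope_mul (g : ℝ → ℝ) (a x : ℝ) : g x = g a + slope g a x * (x - a) := by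
  have := sub_smul_slope g a x
  simp only [smul_eq_mul, vsub_eq_sub] at this
  linarith

theorem chord_right (g : ℝ → ℝ) (a b : ℝ) : chord g a b b = g b := (eq_add_slope_mul g a b).symm

theorem le_chord {g : ℝ → ℝ} {S : Set ℝ} (hg : ConvexOn ℝ S g) {a b x : ℝ}
    (ha : a ∈ S) (hb : b ∈ S) (hx : x ∈ S) (hax : a ≤ x) (hxb : x ≤ b) : g x ≤ chord g a b x := by
  rcases hax.eq_or_lt with rfl | h
  · simp [chord]
  · rw [eq_add_slope_mul g a x, chord]
    have := slope_le_slope_of_convexOn hg ha hx ha hb h (h.trans_le hxb) le_rfl hxb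
    have h2 := mul_le_mul_of_nonneg_right this (sub_nonneg.2 hax)
    linarith

theorem chord_le_of_right {g : ℝ → ℝ} {S : Set ℝ} (hg : ConvexOn ℝ S g) {a b x : ℝ}
    (ha : a ∈ S) (hb : b ∈ S) (hx : x ∈ S) (hab : a < b) (hbx : b ≤ x) : chord g a b x ≤ g x := by
  rw [eq_add_slope_mul g a x, chord]
  have := slope_le_slope_of_convexOn hg ha hb ha hx hab (hab.trans_le hbx) le_rfl hbx
  have h2 := mul_le_mul_of_nonneg_right this (sub_nonneg.2 (hab.le.trans hbx))
  linarith

theorem chord_le_of_left {g : ℝ → ℝ} {S : Set ℝ} (hg : ConvexOn ℝ S g) {a b x : ℝ}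
    (ha : a ∈ S) (hb : b ∈ S) (hx : x ∈ S) (hab : a < b) (hxa : x ≤ a) : chord g a b x ≤ g x := by
  rcases hxa.eq_or_lt with rfl | h
  · simp [chord]
  · rw [eq_add_slope_mul g a x, chord, slope_comm g a x]
    have := slope_le_slope_of_convexOn hg hx ha ha hb h hab h.le hab.le
    have h2 := mul_le_mul_of_nonpos_right this (sub_nonpos.2 hxa)
    linarith

/-- The first integer `z` beyond `a` for which the chord over `[a, z]` exceeds `g` by more than
`log 2` at some integer. -/
noncomputable def firstBad (g : ℝ → ℝ) (a : ℕ) : ℕ :=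
  sInf {z : ℕ | a < z ∧ ∃ w : ℕ, a < w ∧ w < z ∧ g w + Real.log 2 < chord g a z w}

/-- Greedy breakpoints: the next breakpoint is the last integer for which the chord from the current
one stays within `log 2` of `g`. -/
noncomputable def breakpt (g : ℝ → ℝ) : ℕ → ℕ
  | 0 => 0
  | j + 1 => firstBad g (breakpt g j) - 1

/-- The conditions on `log f` that are used to build the exponential envelope. -/
structure IsSlowLog (g : ℝ → ℝ) : Prop where
  convexOn : ConvexOn ℝ (Set.Ici 0) g
  strictAntiOn : StrictAntiOn g (Set.Ici 0)
  zero_neg : g 0 < 0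
  tendsto : Tendsto g atTop atBot
  slow : ∀ ε : ℝ, 0 < ε → ∀ᶠ x : ℝ in atTop, -ε * x ≤ g x

theorem natCast_mem_Ici (n : ℕ) : (n : ℝ) ∈ Set.Ici (0 : ℝ) :=
  Set.mem_Ici.2 (Nat.cast_nonneg n)

namespace IsSlowLog

variable {g : ℝ → ℝ} (hg : IsSlowLog g)
include hg

theorem exists_bad (a : ℕ) :
    ∃ z : ℕ, a < z ∧ ∃ w : ℕ, a < w ∧ w < z ∧ g w + Real.log 2 < chord g a z w := by
  have hga : g a < 0 := lt_of_le_of_lt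
    (hg.strictAntiOn.antitoneOn (Set.mem_Ici.2 le_rfl) (Set.mem_Ici.2 (Nat.cast_nonneg a))
      (Nat.cast_nonneg a)) hg.zero_neg
  have h1 := (hg.tendsto.comp tendsto_natCast_atTop_atTop).eventually_lt_atBot
    (g a - Real.log 2 - 1)
  obtain ⟨w, hw, haw⟩ := (h1.and (eventually_gt_atTop a)).exists
  have hwa : (0 : ℝ) < w - a := by
    have : (a : ℝ) < w := by exact_mod_cast haw
    linarith
  -- with this `ε` a chord of slope at least `-2 ε` drops by at most `1` between `a` and `w`
  set ε : ℝ := 1 / (2 * (w - a)) with hε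
  have hεpos : 0 < ε := by positivity
  have h2 := tendsto_natCast_atTop_atTop.eventually (hg.slow ε hεpos)
  obtain ⟨z, ⟨hz, hwz⟩, h2az⟩ :=
    ((h2.and (eventually_gt_atTop w)).and (eventually_ge_atTop (2 * a))).exists
  refine ⟨z, haw.trans hwz, w, haw, hwz, ?_⟩
  have hza : (0 : ℝ) < z - a := by
    have : (a : ℝ) < z := by exact_mod_cast haw.trans hwz
    linarith
  have h2az' : 2 * (a : ℝ) ≤ z := by exact_mod_cast h2az
  have hs : -(2 * ε) ≤ slope g a z := by
    rw [slope_def_field, le_div_iff₀ hza]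
    nlinarith
  have hs' := mul_le_mul_of_nonneg_right hs hwa.le
  have hεw : 2 * ε * (w - a) = 1 := by rw [hε]; field_simp
  simp only [Function.comp_apply] at hw
  unfold chord
  linarith

theorem firstBad_spec (a : ℕ) : a < firstBad g a ∧ ∃ w : ℕ, a < w ∧ w < firstBad g a ∧
    g w + Real.log 2 < chord g a (firstBad g a) w :=
  Nat.sInf_mem (hg.exists_bad a)

theorem breakpt_succ (j : ℕ) : breakpt g (j + 1) + 1 = firstBad g (breakpt g j) := by
  have := (hg.firstBad_spec (breakpt g j)).1
  simp only [breakpt]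
  omega

theorem breakpt_lt (j : ℕ) : breakpt g j < breakpt g (j + 1) := by
  have h := hg.breakpt_succ j
  obtain ⟨h1, w, h2, h3, -⟩ := hg.firstBad_spec (breakpt g j)
  omega

theorem breakpt_strictMono : StrictMono (breakpt g) := strictMono_nat_of_lt_succ hg.breakpt_lt

/-- Beyond `breakpt g (j + 1)` the chord from `breakpt g j` becomes too high somewhere. -/
theorem exists_chord_gt (j : ℕ) : ∃ w : ℕ, breakpt g j < w ∧ w ≤ breakpt g (j + 1) ∧
    g w + Real.log 2 < chord g (breakpt g j) ((breakpt g (j + 1) + 1 : ℕ) : ℝ) w := by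
  obtain ⟨h1, w, h2, h3, h4⟩ := hg.firstBad_spec (breakpt g j)
  have := hg.breakpt_succ j
  exact ⟨w, h2, by omega, by rwa [this]⟩

theorem chord_le_add_log_two (j n : ℕ) (h1 : breakpt g j ≤ n) (h2 : n ≤ breakpt g (j + 1)) :
    chord g (breakpt g j) (breakpt g (j + 1)) n ≤ g n + Real.log 2 := by
  have hl : 0 < Real.log 2 := Real.log_pos one_lt_two
  rcases h1.eq_or_lt with h1 | h1
  · rw [h1]; simp [chord, hl.le]
  rcases h2.eq_or_lt with h2 | h2
  · rw [← h2, chord_right]; linarith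
  by_contra! hc
  have hm : breakpt g (j + 1) ∈ {z : ℕ | breakpt g j < z ∧ ∃ w : ℕ, breakpt g j < w ∧ w < z ∧
      g w + Real.log 2 < chord g (breakpt g j) z w} := ⟨hg.breakpt_lt j, n, h1, h2, hc⟩
  have := Nat.sInf_le hm
  have h3 := hg.breakpt_succ j
  rw [firstBad] at h3
  omega

theorem slope_le {a b c d : ℕ} (hab : a < b) (hcd : c < d) (hac : a ≤ c) (hbd : b ≤ d) :
    slope g a b ≤ slope g c d :=
  slope_le_slope_of_convexOn hg.convexOn (natCast_mem_Ici a) (natCast_mem_Ici b)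
    (natCast_mem_Ici c) (natCast_mem_Ici d) (by exact_mod_cast hab) (by exact_mod_cast hcd)
    (by exact_mod_cast hac) (by exact_mod_cast hbd)

theorem slope_neg {a b : ℕ} (hab : a < b) : slope g a b < 0 := by
  have hab' : (a : ℝ) < b := by exact_mod_cast hab
  rw [slope_def_field]
  exact div_neg_of_neg_of_pos (sub_neg.2 (hg.strictAntiOn (natCast_mem_Ici a)
    (natCast_mem_Ici b) hab')) (sub_pos.2 hab')

/-- To the left of `breakpt g j` consecutive chords are at distance at least `log 2`. -/
theorem chord_succ_le (j n : ℕ) (hn : n ≤ breakpt g j) :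
    chord g (breakpt g (j + 1)) (breakpt g (j + 2)) n ≤
      chord g (breakpt g j) (breakpt g (j + 1)) n - Real.log 2 := by
  obtain ⟨w, hw1, hw2, hw3⟩ := hg.exists_chord_gt j
  have e1 := hg.breakpt_lt j
  have e2 := hg.breakpt_lt (j + 1)
  have hw4 : chord g (breakpt g (j + 1)) (breakpt g (j + 2)) w ≤ g w :=
    chord_le_of_left hg.convexOn (natCast_mem_Ici _) (natCast_mem_Ici _) (natCast_mem_Ici _)
      (by exact_mod_cast e2) (by exact_mod_cast hw2)
  have s1 := hg.slope_le (a := breakpt g j) (b := breakpt g (j + 1) + 1) (c := breakpt g (j + 1))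
    (d := breakpt g (j + 2)) (by omega) e2 e1.le e2
  have s2 := hg.slope_le (a := breakpt g j) (b := breakpt g (j + 1)) (c := breakpt g j)
    (d := breakpt g (j + 1) + 1) e1 (by omega) le_rfl (by omega)
  have n1 : (n : ℝ) ≤ breakpt g j := by exact_mod_cast hn
  have n2 : (n : ℝ) ≤ w := by exact_mod_cast hn.trans hw1.le
  have p1 := mul_nonneg (sub_nonneg.2 s1) (sub_nonneg.2 n2)
  have p2 := mul_nonneg (sub_nonneg.2 s2) (sub_nonneg.2 n1)
  unfold chord at *
  linarith

/-- To the right of `breakpt g (i + 2)` chords two steps apart are at distance at least `log 2`. -/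
theorem chord_le_add_two (i n : ℕ) (hn : breakpt g (i + 2) + 1 ≤ n) :
    chord g (breakpt g i) (breakpt g (i + 1)) n ≤
      chord g (breakpt g (i + 2)) (breakpt g (i + 3)) n - Real.log 2 := by
  obtain ⟨w, hw1, hw2, hw3⟩ := hg.exists_chord_gt (i + 1)
  have e0 := hg.breakpt_lt i
  have e1 := hg.breakpt_lt (i + 1)
  have e2 := hg.breakpt_lt (i + 2)
  simp only [add_assoc, Nat.reduceAdd] at *
  have hw4 : chord g (breakpt g i) (breakpt g (i + 1)) w ≤ g w :=
    chord_le_of_right hg.convexOn (natCast_mem_Ici _) (natCast_mem_Ici _) (natCast_mem_Ici _)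
      (by exact_mod_cast e0) (by exact_mod_cast hw1.le)
  have s1 := hg.slope_le (a := breakpt g i) (b := breakpt g (i + 1)) (c := breakpt g (i + 1))
    (d := breakpt g (i + 2) + 1) e0 (by omega) e0.le (by omega)
  have s2 := hg.slope_le (a := breakpt g (i + 1)) (b := breakpt g (i + 2) + 1)
    (c := breakpt g (i + 2)) (d := breakpt g (i + 3)) (by omega) e2 e1.le e2
  -- the two chords are compared at `breakpt g (i + 2) + 1`, where the first one meets `g`
  have hc : g ((breakpt g (i + 2) + 1 : ℕ) : ℝ) ≤
      chord g (breakpt g (i + 2)) (breakpt g (i + 3)) ((breakpt g (i + 2) + 1 : ℕ) : ℝ) :=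
    le_chord hg.convexOn (natCast_mem_Ici _) (natCast_mem_Ici _) (natCast_mem_Ici _)
      (by exact_mod_cast (Nat.le_succ _)) (by exact_mod_cast e2)
  rw [← chord_right g (breakpt g (i + 1)) ((breakpt g (i + 2) + 1 : ℕ) : ℝ)] at hc
  have n1 : ((breakpt g (i + 2) + 1 : ℕ) : ℝ) ≤ n := by exact_mod_cast hn
  have n2 : (w : ℝ) ≤ n := by exact_mod_cast hw2.trans ((Nat.le_succ _).trans hn)
  have p1 := mul_nonneg (sub_nonneg.2 s1) (sub_nonneg.2 n2)
  have p2 := mul_nonneg (sub_nonneg.2 s2) (sub_nonneg.2 n1)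
  unfold chord at *
  linarith

theorem exists_breakpt_le (n : ℕ) : ∃ m, breakpt g m ≤ n ∧ n ≤ breakpt g (m + 1) := by
  have hex : ∃ m, n ≤ breakpt g (m + 1) :=
    ⟨n, (hg.breakpt_strictMono.le_apply).trans (hg.breakpt_lt n).le⟩
  classical
  refine ⟨Nat.find hex, ?_, Nat.find_spec hex⟩
  rcases h : Nat.find hex with _ | m
  · simp [breakpt]
  · have := Nat.find_min hex (m := m) (by omega)
    omega

/-- The sum of all the chords, on the exponential scale, is at most `8 exp g`. The chord over the
interval containing `n` contributes `2`, the later ones `1 + 1/2 + ⋯ = 2`, and the earlier ones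
`2 (1 + 1/2 + ⋯) = 4`. -/
theorem sum_exp_chord_le (n N : ℕ) :
    ∑ j ∈ Finset.range N, Real.exp (chord g (breakpt g j) (breakpt g (j + 1)) n) ≤
      8 * Real.exp (g n) := by
  set E : ℕ → ℝ := fun j => Real.exp (chord g (breakpt g j) (breakpt g (j + 1)) n) with hE
  have hEpos : ∀ j, 0 ≤ E j := fun j => (Real.exp_pos _).le
  set F := Real.exp (g n) with hF
  have hFpos : 0 < F := Real.exp_pos _
  have hlog : ∀ a b : ℝ, a ≤ b - Real.log 2 → Real.exp a ≤ Real.exp b / 2 := by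
    intro a b h
    have := Real.exp_le_exp.2 h
    rwa [Real.exp_sub, Real.exp_log two_pos] at this
  obtain ⟨m, hm1, hm2⟩ := hg.exists_breakpt_le n
  have hmid : E m ≤ 2 * F := by
    have := Real.exp_le_exp.2 (hg.chord_le_add_log_two m n hm1 hm2)
    rw [Real.exp_add, Real.exp_log two_pos] at this
    simp only [hE, hF]; linarith
  have hright : ∀ i, E (m + 1 + i) ≤ F * (1 / 2) ^ i := by
    intro i
    induction i with
    | zero =>
      simp only [pow_zero, mul_one, add_zero, hE, hF]
      exact Real.exp_le_exp.2 (chord_le_of_left hg.convexOn (natCast_mem_Ici _) (natCast_mem_Ici _)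
        (natCast_mem_Ici _) (by exact_mod_cast hg.breakpt_lt _) (by exact_mod_cast hm2))
    | succ i ih =>
      have : E (m + 1 + (i + 1)) ≤ E (m + 1 + i) / 2 :=
        hlog _ _ (hg.chord_succ_le (m + 1 + i) n
          (hm2.trans (hg.breakpt_strictMono.monotone (by omega))))
      rw [pow_succ]; linarith
  have hleft : ∀ j, j < m → E j ≤ F := fun j hj =>
    Real.exp_le_exp.2 (chord_le_of_right hg.convexOn (natCast_mem_Ici _) (natCast_mem_Ici _)
      (natCast_mem_Ici _) (by exact_mod_cast hg.breakpt_lt _)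
      (by exact_mod_cast (hg.breakpt_strictMono.monotone (by omega : j + 1 ≤ m)).trans hm1))
  have hleft2 : ∀ j, j + 2 < m → E j ≤ E (j + 2) / 2 := fun j hj =>
    hlog _ _ (hg.chord_le_add_two j n
      ((Nat.succ_le_of_lt (hg.breakpt_strictMono hj)).trans hm1))
  have hS : ∑ j ∈ Finset.range m, E j ≤ 4 * F := by
    rcases m with _ | _ | m
    · simp; positivity
    · simp; linarith [hleft 0 (by omega)]
    · have h1 : ∑ j ∈ Finset.range m, E j ≤ (∑ j ∈ Finset.range m, E (j + 2)) / 2 := by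
        rw [Finset.sum_div]
        exact Finset.sum_le_sum fun j hj => hleft2 j (by have := Finset.mem_range.1 hj; omega)
      have h2 : ∑ j ∈ Finset.range m, E (j + 2) ≤ ∑ j ∈ Finset.range (m + 2), E j := by
        rw [Finset.sum_range_succ', Finset.sum_range_succ']
        linarith [hEpos 0, hEpos (0 + 1)]
      rw [Finset.sum_range_succ, Finset.sum_range_succ] at h2 ⊢
      linarith [hleft m (by omega), hleft (m + 1) (by omega)]
  have hT : ∑ i ∈ Finset.range N, E (m + 1 + i) ≤ 2 * F := by
    calc ∑ i ∈ Finset.range N, E (m + 1 + i) ≤ ∑ i ∈ Finset.range N, F * (1 / 2) ^ i :=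
          Finset.sum_le_sum fun i _ => hright i
      _ ≤ 2 * F := by
          rw [← Finset.mul_sum, mul_comm]
          exact mul_le_mul_of_nonneg_right (sum_geometric_two_le N) hFpos.le
  calc ∑ j ∈ Finset.range N, E j ≤ ∑ j ∈ Finset.range (m + 1 + N), E j :=
        Finset.sum_le_sum_of_subset_of_nonneg (Finset.range_subset_range.2 (by omega))
          fun j _ _ => hEpos j
    _ = ∑ j ∈ Finset.range m, E j + E m + ∑ i ∈ Finset.range N, E (m + 1 + i) := by
        rw [Finset.sum_range_add, Finset.sum_range_succ]
    _ ≤ 8 * F := by linarith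

theorem exists_slope_gt (ε : ℝ) (hε : 0 < ε) :
    ∃ j, -ε < slope g (breakpt g j) (breakpt g (j + 1)) := by
  by_contra! hc
  have key : ∀ j, g (breakpt g j) ≤ g 0 - ε * breakpt g j := by
    intro j
    induction j with
    | zero => simp [breakpt]
    | succ j ih =>
      have h1 : (0 : ℝ) ≤ breakpt g (j + 1) - breakpt g j :=
        sub_nonneg.2 (by exact_mod_cast (hg.breakpt_lt j).le)
      rw [eq_add_slope_mul g (breakpt g j) (breakpt g (j + 1))]
      have := mul_le_mul_of_nonneg_right (hc j) h1
      linarith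
  have ht : Tendsto (fun j => (breakpt g j : ℝ)) atTop atTop :=
    tendsto_natCast_atTop_atTop.comp hg.breakpt_strictMono.tendsto_atTop
  obtain ⟨j, hj⟩ := (ht.eventually (hg.slow ε hε)).exists
  linarith [key j, hg.zero_neg]

end IsSlowLog

/-- A log-convex function that decays to `0` more slowly than every exponential is comparable, at
the integers, with both the supremum and the sum of countably many exponentials `C j * u j ^ n`. -/
theorem exists_exponential_envelope (f : ℝ → ℝ)
    (hf_range : ∀ x, 0 ≤ x → f x ∈ Set.Ioc (0 : ℝ) (1 / 2))
    (hf_anti : StrictAntiOn f (Set.Ici 0)) (hf_lim : Tendsto f atTop (𝓝 0))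
    (hf_slow : ∀ u ∈ Set.Ioo (0 : ℝ) 1, (fun x : ℝ => u ^ x) =o[atTop] f)
    (hf_conv : ConvexOn ℝ (Set.Ici 0) (fun x => Real.log (f x))) :
    ∃ C u : ℕ → ℝ, (∀ j, 0 < C j) ∧ C 0 ≤ 1 / 2 ∧ StrictAnti C ∧ (∀ j, u j ∈ Set.Ioo (0 : ℝ) 1) ∧
      Monotone u ∧ (∀ v < 1, ∃ j, v < u j) ∧
      (∀ n : ℕ, ∃ j, f n ≤ C j * u j ^ n) ∧
      ∀ n N : ℕ, ∑ j ∈ Finset.range N, C j * u j ^ n ≤ 8 * f n := by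
  have hpos : ∀ x, 0 ≤ x → 0 < f x := fun x hx => (hf_range x hx).1
  set g : ℝ → ℝ := fun x => Real.log (f x) with hgdef
  have hg : IsSlowLog g :=
    { convexOn := hf_conv
      strictAntiOn := fun x hx y hy hxy => Real.log_lt_log (hpos y hy) (hf_anti hx hy hxy)
      zero_neg := Real.log_neg (hpos 0 le_rfl)
        ((hf_range 0 le_rfl).2.trans_lt (by norm_num))
      tendsto := by
        refine Real.tendsto_log_nhdsGT_zero.comp (tendsto_nhdsWithin_iff.2 ⟨hf_lim, ?_⟩)
        filter_upwards [eventually_ge_atTop 0] with x hx using hpos x hx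
      slow := by
        intro ε hε
        have h := (hf_slow (Real.exp (-ε)) ⟨Real.exp_pos _, by simpa using hε⟩).bound one_pos
        filter_upwards [h, eventually_ge_atTop 0] with x hx hx0
        rw [Real.norm_of_nonneg (Real.rpow_nonneg (Real.exp_pos _).le _),
          Real.norm_of_nonneg (hpos x hx0).le, one_mul, ← Real.exp_mul] at hx
        exact (Real.le_log_iff_exp_le (hpos x hx0)).2 hx }
  set b : ℕ → ℝ := fun j => slope g (breakpt g j) (breakpt g (j + 1)) with hb
  set M : ℕ → ℝ → ℝ := fun j => chord g (breakpt g j) (breakpt g (j + 1)) with hM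
  have hexp : ∀ j (n : ℕ), Real.exp (M j 0) * Real.exp (b j) ^ n = Real.exp (M j n) := by
    intro j n
    rw [← Real.exp_nat_mul, ← Real.exp_add]
    congr 1
    simp only [hM, hb, chord]; ring
  have hlog : ∀ n : ℕ, Real.exp (g n) = f n := fun n => Real.exp_log (hpos n (Nat.cast_nonneg n))
  refine ⟨fun j => Real.exp (M j 0), fun j => Real.exp (b j), fun j => Real.exp_pos _, ?_, ?_,
    fun j => ⟨Real.exp_pos _, ?_⟩, ?_, ?_, ?_, ?_⟩
  · have : M 0 0 = g 0 := by simp [hM, chord, breakpt]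
    change Real.exp (M 0 0) ≤ 1 / 2
    rw [this]
    have := hlog 0
    simp only [Nat.cast_zero] at this
    rw [this]
    exact (hf_range 0 le_rfl).2
  · refine strictAnti_nat_of_succ_lt fun j => Real.exp_lt_exp.2 ?_
    have := hg.chord_succ_le j 0 (Nat.zero_le _)
    have hl : 0 < Real.log 2 := Real.log_pos one_lt_two
    simp only [Nat.cast_zero] at this
    simp only [hM]; linarith
  · simpa using hg.slope_neg (hg.breakpt_lt j)
  · refine monotone_nat_of_le_succ fun j => Real.exp_le_exp.2 ?_
    exact hg.slope_le (hg.breakpt_lt j) (hg.breakpt_lt (j + 1)) (hg.breakpt_lt j).le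
      (hg.breakpt_lt (j + 1)).le
  · intro v hv
    rcases le_or_gt v 0 with h0 | h0
    · exact ⟨0, h0.trans_lt (Real.exp_pos _)⟩
    · obtain ⟨j, hj⟩ := hg.exists_slope_gt (-Real.log v) (neg_pos.2 (Real.log_neg h0 hv))
      refine ⟨j, (Real.log_lt_iff_lt_exp h0).1 ?_⟩
      simpa using hj
  · intro n
    obtain ⟨m, h1, h2⟩ := hg.exists_breakpt_le n
    refine ⟨m, ?_⟩
    rw [hexp, ← hlog]
    exact Real.exp_le_exp.2 (le_chord hg.convexOn (natCast_mem_Ici _) (natCast_mem_Ici _)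
      (natCast_mem_Ici _) (by exact_mod_cast h1) (by exact_mod_cast h2))
  · intro n N
    simp_rw [hexp, ← hlog]
    exact hg.sum_exp_chord_le n N

/-! ### Two-sided chains with prescribed reversible transition probabilities -/

/-- `ν` is the law of a two-sided Markov chain on `ℕ` with stationary law `p` and transition
probabilities `q`, expressed through the probabilities of the paths over finite windows. -/
def IsChainLaw (p : PMF ℕ) (q : ℕ → PMF ℕ) (ν : Measure (ℤ → ℕ)) : Prop :=
  ∀ (k : ℤ) (m : ℕ) (s : ℤ → ℕ), ν {y | ∀ i ∈ Finset.Icc k (k + m), y i = s i} =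
    p (s k) * ∏ i ∈ Finset.range m, q (s (k + i)) (s (k + i + 1))

/-- The neighbour of `k` in the direction of the origin. -/
def towardZero (k : ℤ) : ℤ := k - k.sign

/-- The state from which the chain jumps when it is run from time `0` to time `k`, in either
direction of time; by convention the state `0` if `k = 0`. -/
def parentState (s : ℤ → ℕ) (k : ℤ) : ℕ := if k = 0 then 0 else s (towardZero k)

/-- Laws of the independent jump instructions: the instruction with index `(k, a)` is the state at
time `k` of a chain which is in state `a` at the preceding step of its way from time `0` to
time `k`. The instruction `(0, 0)` is the state at time `0`. -/
noncomputable def noiseLaw (p : PMF ℕ) (q : ℕ → PMF ℕ) (i : ℤ × ℕ) : Measure ℕ :=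
  if i.1 = 0 then p.toMeasure else (q i.2).toMeasure

instance (p : PMF ℕ) (q : ℕ → PMF ℕ) (i : ℤ × ℕ) : IsProbabilityMeasure (noiseLaw p q i) := by
  unfold noiseLaw; split_ifs <;> infer_instance

/-- The states visited from time `0` on, forwards if `ε = 1` and backwards if `ε = -1`. -/
def halfPath (ε : ℤ) (ω : ℤ × ℕ → ℕ) : ℕ → ℕ
  | 0 => ω (0, 0)
  | n + 1 => ω (ε * (n + 1), halfPath ε ω n)

/-- The two-sided path read off from the jump instructions. -/
def path (ω : ℤ × ℕ → ℕ) (k : ℤ) : ℕ := halfPath k.sign ω k.natAbs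

theorem path_eq (ω : ℤ × ℕ → ℕ) (k : ℤ) : path ω k = ω (k, parentState (path ω) k) := by
  rcases lt_trichotomy k 0 with hk | rfl | hk
  · obtain ⟨n, rfl⟩ : ∃ n : ℕ, k = -(n + 1) := ⟨(-k).toNat - 1, by omega⟩
    have h1 : (-((n : ℤ) + 1)).sign = -1 := Int.sign_eq_neg_one_of_neg hk
    have h2 : (-((n : ℤ) + 1)).natAbs = n + 1 := by omega
    have h3 : path ω (-((n : ℤ) + 1) - -1) = halfPath (-1) ω n := by
      rcases n with _ | n
      · simp [path, halfPath]
      · have : (-(((n + 1 : ℕ) : ℤ) + 1) - -1) = -((n : ℤ) + 1) := by push_cast; ring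
        rw [path, this, Int.sign_eq_neg_one_of_neg (by omega)]
        congr 1
    rw [parentState, if_neg hk.ne, towardZero, h1, h3, path, h1, h2, halfPath]
    congr 2
    ring
  · simp [path, halfPath, parentState]
  · obtain ⟨n, rfl⟩ : ∃ n : ℕ, k = n + 1 := ⟨k.toNat - 1, by omega⟩
    have h1 : ((n : ℤ) + 1).sign = 1 := Int.sign_eq_one_of_pos hk
    have h2 : ((n : ℤ) + 1).natAbs = n + 1 := by omega
    have h3 : path ω ((n : ℤ) + 1 - 1) = halfPath 1 ω n := by
      rcases n with _ | n
      · simp [path, halfPath]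
      · have : (((n + 1 : ℕ) : ℤ) + 1 - 1) = (n : ℤ) + 1 := by push_cast; ring
        rw [path, this, Int.sign_eq_one_of_pos (by omega)]
        congr 1
    rw [parentState, if_neg hk.ne', towardZero, h1, h3, path, h1, h2, halfPath]
    congr 2
    ring

theorem measurable_halfPath (ε : ℤ) (n : ℕ) : Measurable fun ω => halfPath ε ω n := by
  induction n with
  | zero => exact measurable_pi_apply _
  | succ n ih =>
    have : Measurable fun x : ℕ × (ℤ × ℕ → ℕ) => x.2 (ε * (n + 1), x.1) :=
      measurable_from_prod_countable_right fun a =>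
        (measurable_pi_apply (ε * (n + 1), a) : Measurable fun y : ℤ × ℕ → ℕ => y (ε * (n + 1), a))
    exact this.comp (ih.prodMk measurable_id)

theorem measurable_path : Measurable path :=
  measurable_pi_lambda _ fun _ => measurable_halfPath _ _

theorem path_eq_iff (ω : ℤ × ℕ → ℕ) (s : ℤ → ℕ) (N : ℕ) :
    (∀ k ∈ Finset.Icc (-N : ℤ) N, path ω k = s k) ↔
      ∀ k ∈ Finset.Icc (-N : ℤ) N, ω (k, parentState s k) = s k := by
  have hmem : ∀ k ∈ Finset.Icc (-N : ℤ) N, towardZero k ∈ Finset.Icc (-N : ℤ) N := by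
    intro k hk
    rw [Finset.mem_Icc] at *
    unfold towardZero
    rcases lt_trichotomy k 0 with h | rfl | h
    · rw [Int.sign_eq_neg_one_of_neg h]; omega
    · simp
    · rw [Int.sign_eq_one_of_pos h]; omega
  constructor
  · intro h k hk
    rw [← h k hk, path_eq]
    congr 2
    unfold parentState
    split_ifs
    · rfl
    · exact (h _ (hmem k hk)).symm
  · intro h k hk
    induction hn : k.natAbs using Nat.strong_induction_on generalizing k with
    | _ n ih =>
      rw [path_eq, ← h k hk]
      congr 2
      unfold parentState
      split_ifs with h0
      · rfl
      · refine ih _ ?_ _ (hmem k hk) rfl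
        unfold towardZero
        rcases lt_or_gt_of_ne h0 with h | h
        · rw [Int.sign_eq_neg_one_of_neg h]; omega
        · rw [Int.sign_eq_one_of_pos h]; omega

section Chain

variable {p : PMF ℕ} {q : ℕ → PMF ℕ}

theorem infinitePi_path_eq (s : ℤ → ℕ) (N : ℕ) :
    Measure.infinitePi (noiseLaw p q) {ω | ∀ k ∈ Finset.Icc (-N : ℤ) N, path ω k = s k} =
      ∏ k ∈ Finset.Icc (-N : ℤ) N, noiseLaw p q (k, parentState s k) {s k} := by
  set e : ℤ ↪ ℤ × ℕ := ⟨fun k => (k, parentState s k), fun a b h => congrArg Prod.fst h⟩ with he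
  have hset : {ω | ∀ k ∈ Finset.Icc (-N : ℤ) N, path ω k = s k} =
      Set.pi ((Finset.Icc (-N : ℤ) N).map e : Finset (ℤ × ℕ)) fun i => {s i.1} := by
    ext ω
    simp only [Set.mem_ofPred_eq, path_eq_iff, Set.mem_pi, Finset.mem_coe, Finset.mem_map,
      Set.mem_singleton_iff]
    exact ⟨fun h i ⟨k, hk, hi⟩ => hi ▸ h k hk, fun h k hk => h _ ⟨k, hk, rfl⟩⟩
  rw [hset, Measure.infinitePi_pi _ fun i _ => measurableSet_singleton _, Finset.prod_map]
  rfl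

theorem prod_noiseLaw (hrev : ∀ a b, p a * q a b = p b * q b a) (s : ℤ → ℕ) (N : ℕ) :
    ∏ k ∈ Finset.Icc (-N : ℤ) N, noiseLaw p q (k, parentState s k) {s k} =
      p (s (-N)) * ∏ i ∈ Finset.range (2 * N), q (s (-N + i)) (s (-N + i + 1)) := by
  have hsing : ∀ (r : PMF ℕ) (a : ℕ), r.toMeasure {a} = r a := fun r a =>
    r.toMeasure_apply_singleton a (measurableSet_singleton a)
  induction N with
  | zero => simp [noiseLaw, hsing]
  | succ N ih =>
    have hI : Finset.Icc (-((N + 1 : ℕ) : ℤ)) ((N + 1 : ℕ) : ℤ) =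
        insert (-(N : ℤ) - 1) (insert ((N : ℤ) + 1) (Finset.Icc (-N : ℤ) N)) := by
      ext k; simp only [Finset.mem_Icc, Finset.mem_insert]; push_cast; omega
    have e1 : noiseLaw p q ((-(N : ℤ) - 1), parentState s (-(N : ℤ) - 1)) {s (-(N : ℤ) - 1)} =
        q (s (-N)) (s (-(N : ℤ) - 1)) := by
      have h0 : (-(N : ℤ) - 1) ≠ 0 := by omega
      have h1 : towardZero (-(N : ℤ) - 1) = -N := by
        rw [towardZero, Int.sign_eq_neg_one_of_neg (by omega)]; ring
      rw [noiseLaw, if_neg h0, hsing, parentState, if_neg h0, h1]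
    have e2 : noiseLaw p q (((N : ℤ) + 1), parentState s ((N : ℤ) + 1)) {s ((N : ℤ) + 1)} =
        q (s N) (s ((N : ℤ) + 1)) := by
      have h0 : ((N : ℤ) + 1) ≠ 0 := by omega
      have h1 : towardZero ((N : ℤ) + 1) = N := by
        rw [towardZero, Int.sign_eq_one_of_pos (by omega)]; ring
      rw [noiseLaw, if_neg h0, hsing, parentState, if_neg h0, h1]
    rw [hI, Finset.prod_insert (by simp; omega), Finset.prod_insert (by simp), e1, e2, ih,
      show 2 * (N + 1) = (2 * N + 1) + 1 by ring, Finset.prod_range_succ']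
    have e3 : ∀ i : ℕ, q (s (-((N + 1 : ℕ) : ℤ) + (i + 1 : ℕ)))
        (s (-((N + 1 : ℕ) : ℤ) + (i + 1 : ℕ) + 1)) =
        q (s (-N + i)) (s (-N + i + 1)) := by
      intro i
      congr 2 <;> (push_cast; ring_nf)
    simp_rw [e3]
    rw [Finset.prod_range_succ]
    have e4 : (-((N + 1 : ℕ) : ℤ)) = -(N : ℤ) - 1 := by push_cast; ring
    have e5 : (-(N : ℤ) + ((2 * N : ℕ) : ℤ)) = N := by push_cast; ring
    simp only [e4, e5, Nat.cast_zero, add_zero, sub_add_cancel]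
    have := hrev (s (-N)) (s (-(N : ℤ) - 1))
    calc _ = (p (s (-N)) * q (s (-N)) (s (-(N : ℤ) - 1))) * (q (s N) (s ((N : ℤ) + 1)) *
          ∏ i ∈ Finset.range (2 * N), q (s (-N + i)) (s (-N + i + 1))) := by ring
      _ = _ := by rw [this]; ring

theorem measurableSet_window (I : Finset ℤ) (s : ℤ → ℕ) :
    MeasurableSet {y : ℤ → ℕ | ∀ i ∈ I, y i = s i} := by
  have : {y : ℤ → ℕ | ∀ i ∈ I, y i = s i} = ⋂ i ∈ I, (fun y => y i) ⁻¹' {s i} := by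
    ext y; simp
  rw [this]
  exact I.measurableSet_biInter fun i _ => measurable_pi_apply i (measurableSet_singleton _)

/-- Summing out one further coordinate of a window. -/
theorem measure_window_eq_tsum (ν : Measure (ℤ → ℕ)) {I : Finset ℤ} {k : ℤ} (hk : k ∉ I)
    (s : ℤ → ℕ) : ν {y | ∀ i ∈ I, y i = s i} =
      ∑' a, ν {y | ∀ i ∈ insert k I, y i = Function.update s k a i} := by
  rw [← measure_iUnion]
  · congr 1
    ext y
    simp only [Set.mem_ofPred_eq, Finset.mem_insert, forall_eq_or_imp, Set.mem_iUnion,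
      Function.update_self]
    have : ∀ a, (∀ i ∈ I, y i = Function.update s k a i) ↔ ∀ i ∈ I, y i = s i := fun a =>
      forall₂_congr fun i hi => by rw [Function.update_of_ne (by rintro rfl; exact hk hi)]
    simp [this]
  · intro a b hab
    refine Set.disjoint_left.2 fun y ha hb => hab ?_
    have h1 := ha k (Finset.mem_insert_self _ _)
    have h2 := hb k (Finset.mem_insert_self _ _)
    simp only [Function.update_self] at h1 h2
    exact h1.symm.trans h2
  · exact fun a => measurableSet_window _ _

theorem tsum_mul_of_reversible (hrev : ∀ a b, p a * q a b = p b * q b a) (b : ℕ) :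
    ∑' a, p a * q a b = p b := by
  simp_rw [hrev _ b]
  rw [ENNReal.tsum_mul_left, PMF.tsum_coe, mul_one]

/-- The path probabilities over symmetric windows around `0` determine the others. -/
theorem isChainLaw_of_symm_window {ν : Measure (ℤ → ℕ)}
    (hrev : ∀ a b, p a * q a b = p b * q b a)
    (h : ∀ (N : ℕ) (s : ℤ → ℕ), ν {y | ∀ i ∈ Finset.Icc (-N : ℤ) N, y i = s i} =
      p (s (-N)) * ∏ i ∈ Finset.range (2 * N), q (s (-N + i)) (s (-N + i + 1))) :
    IsChainLaw p q ν := by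
  have hright : ∀ (k : ℤ) (m : ℕ),
      (∀ s : ℤ → ℕ, ν {y | ∀ i ∈ Finset.Icc k (k + (m + 1 : ℕ)), y i = s i} =
        p (s k) * ∏ i ∈ Finset.range (m + 1), q (s (k + i)) (s (k + i + 1))) →
      ∀ s : ℤ → ℕ, ν {y | ∀ i ∈ Finset.Icc k (k + m), y i = s i} =
        p (s k) * ∏ i ∈ Finset.range m, q (s (k + i)) (s (k + i + 1)) := by
    intro k m hm s
    have hI : insert (k + m + 1) (Finset.Icc k (k + m)) = Finset.Icc k (k + (m + 1 : ℕ)) := by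
      ext i; simp only [Finset.mem_Icc, Finset.mem_insert]; push_cast; omega
    rw [measure_window_eq_tsum ν (k := k + m + 1) (by simp), hI]
    have hu : ∀ a (i : ℤ), i ≤ k + m → Function.update s (k + m + 1) a i = s i := fun a i hi =>
      Function.update_of_ne (by omega) _ _
    simp_rw [hm, Finset.prod_range_succ]
    have hterm : ∀ a, p (Function.update s (k + m + 1) a k) * ((∏ i ∈ Finset.range m,
        q (Function.update s (k + m + 1) a (k + i)) (Function.update s (k + m + 1) a (k + i + 1))) *
        q (Function.update s (k + m + 1) a (k + m)) (Function.update s (k + m + 1) a (k + m + 1))) =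
        (p (s k) * ∏ i ∈ Finset.range m, q (s (k + i)) (s (k + i + 1))) * q (s (k + m)) a := by
      intro a
      rw [hu a k (by omega), hu a (k + m) le_rfl, Function.update_self, ← mul_assoc]
      congr 2
      refine Finset.prod_congr rfl fun i hi => ?_
      have := Finset.mem_range.1 hi
      rw [hu a _ (by omega), hu a _ (by omega)]
    simp_rw [hterm]
    rw [ENNReal.tsum_mul_left, PMF.tsum_coe, mul_one]
  have hleft : ∀ (k : ℤ) (m : ℕ),
      (∀ s : ℤ → ℕ, ν {y | ∀ i ∈ Finset.Icc k (k + (m + 1 : ℕ)), y i = s i} =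
        p (s k) * ∏ i ∈ Finset.range (m + 1), q (s (k + i)) (s (k + i + 1))) →
      ∀ s : ℤ → ℕ, ν {y | ∀ i ∈ Finset.Icc (k + 1) (k + 1 + m), y i = s i} =
        p (s (k + 1)) * ∏ i ∈ Finset.range m, q (s (k + 1 + i)) (s (k + 1 + i + 1)) := by
    intro k m hm s
    have hI : insert k (Finset.Icc (k + 1) (k + 1 + m)) = Finset.Icc k (k + (m + 1 : ℕ)) := by
      ext i; simp only [Finset.mem_Icc, Finset.mem_insert]; push_cast; omega
    rw [measure_window_eq_tsum ν (k := k) (by simp), hI]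
    have hu : ∀ a (i : ℤ), k < i → Function.update s k a i = s i := fun a i hi =>
      Function.update_of_ne hi.ne' _ _
    simp_rw [hm, Finset.prod_range_succ']
    have hterm : ∀ a, p (Function.update s k a k) * ((∏ i ∈ Finset.range m,
        q (Function.update s k a (k + (i + 1 : ℕ))) (Function.update s k a (k + (i + 1 : ℕ) + 1))) *
        q (Function.update s k a (k + (0 : ℕ))) (Function.update s k a (k + (0 : ℕ) + 1))) =
        (p a * q a (s (k + 1))) *
          ∏ i ∈ Finset.range m, q (s (k + 1 + i)) (s (k + 1 + i + 1)) := by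
      intro a
      rw [Nat.cast_zero, add_zero, Function.update_self, hu a (k + 1) (by omega),
        mul_comm (∏ i ∈ Finset.range m, _), ← mul_assoc]
      congr 1
      refine Finset.prod_congr rfl fun i hi => ?_
      rw [hu a _ (by omega), hu a _ (by omega)]
      congr 2 <;> (push_cast; ring_nf)
    simp_rw [hterm]
    rw [ENNReal.tsum_mul_right, tsum_mul_of_reversible hrev]
  intro k m
  -- the given window arises from `[-N, N]` by removing points, first on the right
  obtain ⟨N, a, b, hk, hN⟩ : ∃ N a b : ℕ, k = -N + a ∧ 2 * N = a + m + b :=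
    ⟨k.natAbs + m, (k + (k.natAbs + m : ℕ)).toNat,
      2 * (k.natAbs + m) - (k + (k.natAbs + m : ℕ)).toNat - m, by omega, by omega⟩
  have hstart : ∀ s : ℤ → ℕ, ν {y | ∀ i ∈ Finset.Icc (-N : ℤ) (-N + (a + m + b : ℕ)), y i = s i} =
      p (s (-N)) * ∏ i ∈ Finset.range (a + m + b), q (s (-N + i)) (s (-N + i + 1)) := by
    intro s
    rw [← hN, ← h N s, show (-(N : ℤ) + ((2 * N : ℕ) : ℤ)) = N by push_cast; ring]
  have h1 : ∀ b : ℕ, (∀ s : ℤ → ℕ,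
      ν {y | ∀ i ∈ Finset.Icc (-N : ℤ) (-N + (a + m + b : ℕ)), y i = s i} =
        p (s (-N)) * ∏ i ∈ Finset.range (a + m + b), q (s (-N + i)) (s (-N + i + 1))) →
      ∀ s : ℤ → ℕ, ν {y | ∀ i ∈ Finset.Icc (-N : ℤ) (-N + (a + m : ℕ)), y i = s i} =
        p (s (-N)) * ∏ i ∈ Finset.range (a + m), q (s (-N + i)) (s (-N + i + 1)) := by
    intro b
    induction b with
    | zero => exact fun h => h
    | succ b ih => exact fun h => ih (hright _ (a + m + b) h)
  have h2 : ∀ (a : ℕ) (k : ℤ), (∀ s : ℤ → ℕ,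
      ν {y | ∀ i ∈ Finset.Icc k (k + (a + m : ℕ)), y i = s i} =
        p (s k) * ∏ i ∈ Finset.range (a + m), q (s (k + i)) (s (k + i + 1))) →
      ∀ s : ℤ → ℕ, ν {y | ∀ i ∈ Finset.Icc (k + a) (k + a + m), y i = s i} =
        p (s (k + a)) * ∏ i ∈ Finset.range m, q (s (k + a + i)) (s (k + a + i + 1)) := by
    intro a
    induction a with
    | zero => intro k h; simpa using h
    | succ a ih =>
      intro k h
      rw [show a + 1 + m = a + m + 1 by ring] at h
      have := ih (k + 1) (hleft k (a + m) h)
      rwa [show k + 1 + (a : ℤ) = k + (a + 1 : ℕ) by push_cast; ring] at this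
  rw [hk]
  exact h2 a _ (h1 b hstart)

/-- Existence of a two-sided chain: draw the state at time `0` from the reversible law `p` and run
the chain with independent instructions forwards and backwards in time. -/
theorem exists_isChainLaw (hrev : ∀ a b, p a * q a b = p b * q b a) :
    ∃ ν : Measure (ℤ → ℕ), IsProbabilityMeasure ν ∧ IsChainLaw p q ν := by
  refine ⟨(Measure.infinitePi (noiseLaw p q)).map path,
    Measure.isProbabilityMeasure_map measurable_path.aemeasurable,
    isChainLaw_of_symm_window hrev fun N s => ?_⟩
  rw [Measure.map_apply measurable_path (measurableSet_window _ _), ← prod_noiseLaw hrev,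
    ← infinitePi_path_eq]
  rfl

end Chain

/-! ### Stationarity, reversibility and the Markov property -/

/-- The coordinate process on `ℤ → ℕ`, regarded as real-valued. -/
def coordReal (k : ℤ) (y : ℤ → ℕ) : ℝ := y k

theorem measurable_coordReal (k : ℤ) : Measurable (coordReal k) :=
  (measurable_of_countable fun n : ℕ => (n : ℝ)).comp (measurable_pi_apply k)

/-- The events which fix the path over one of the windows `I N`. -/
def windowSets (I : ℕ → Finset ℤ) : Set (Set (ℤ → ℕ)) :=
  {C | ∃ (N : ℕ) (s : ℤ → ℕ), C = {y | ∀ i ∈ I N, y i = s i}}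

theorem isPiSystem_windowSets {I : ℕ → Finset ℤ} (hI : Monotone I) :
    IsPiSystem (windowSets I) := by
  rintro _ ⟨N, s, rfl⟩ _ ⟨M, t, rfl⟩ ⟨y, hy1, hy2⟩
  refine ⟨max N M, y, ?_⟩
  ext z
  simp only [Set.mem_inter_iff, Set.mem_ofPred_eq] at *
  constructor
  · rintro ⟨h1, h2⟩ i hi
    rcases max_choice N M with h | h <;> rw [h] at hi
    · rw [h1 i hi, hy1 i hi]
    · rw [h2 i hi, hy2 i hi]
  · intro h
    exact ⟨fun i hi => by rw [h i (hI (le_max_left _ _) hi), hy1 i hi],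
      fun i hi => by rw [h i (hI (le_max_right _ _) hi), hy2 i hi]⟩

theorem iSup_comap_coordReal_eq {I : ℕ → Finset ℤ} {S : ℤ → Prop}
    (hS : ∀ j, S j ↔ ∃ N, j ∈ I N) :
    ⨆ j, ⨆ _ : S j, MeasurableSpace.comap (coordReal j) Real.measurableSpace =
      MeasurableSpace.generateFrom (windowSets I) := by
  apply le_antisymm
  · refine iSup₂_le fun j hj => ?_
    obtain ⟨N, hN⟩ := (hS j).1 hj
    rintro _ ⟨B, hB, rfl⟩
    have : coordReal j ⁻¹' B = ⋃ v : {v : I N → ℕ // (v ⟨j, hN⟩ : ℝ) ∈ B},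
        {y | ∀ i ∈ I N, y i = if h : i ∈ I N then v.1 ⟨i, h⟩ else 0} := by
      ext y
      simp only [Set.mem_preimage, Set.mem_iUnion, Set.mem_ofPred_eq]
      constructor
      · intro h
        exact ⟨⟨fun i => y i, h⟩, fun i hi => by simp [hi]⟩
      · rintro ⟨⟨v, hv⟩, h⟩
        have := h j hN
        rw [dif_pos hN] at this
        rwa [coordReal, this]
    rw [this]
    exact @MeasurableSet.iUnion _ _ (MeasurableSpace.generateFrom (windowSets I)) _ _
      fun v => MeasurableSpace.measurableSet_generateFrom ⟨N, _, rfl⟩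
  · refine MeasurableSpace.generateFrom_le ?_
    rintro _ ⟨N, s, rfl⟩
    have : {y : ℤ → ℕ | ∀ i ∈ I N, y i = s i} = ⋂ i ∈ I N, coordReal i ⁻¹' {(s i : ℝ)} := by
      ext y; simp [coordReal]
    rw [this]
    refine Finset.measurableSet_biInter _ fun i hi => ?_
    exact le_iSup₂
      (f := fun j (_ : S j) => MeasurableSpace.comap (coordReal j) Real.measurableSpace) i ((hS i).2 ⟨N, hi⟩) _ ⟨_, measurableSet_singleton _, rfl⟩

theorem past_coordReal (k : ℤ) : past coordReal k =
    MeasurableSpace.generateFrom (windowSets fun N => Finset.Icc (k - N) k) :=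
  iSup_comap_coordReal_eq fun j => by
    simp only [Finset.mem_Icc]
    exact ⟨fun h => ⟨(k - j).toNat, by omega, h⟩, fun ⟨_, _, h⟩ => h⟩

theorem future_coordReal (k : ℤ) : future coordReal k =
    MeasurableSpace.generateFrom (windowSets fun N => Finset.Icc k (k + N)) :=
  iSup_comap_coordReal_eq fun j => by
    simp only [Finset.mem_Icc]
    exact ⟨fun h => ⟨(j - k).toNat, h, by omega⟩, fun ⟨_, h, _⟩ => h⟩

theorem pi_eq_generateFrom_windowSets : (MeasurableSpace.pi : MeasurableSpace (ℤ → ℕ)) =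
    MeasurableSpace.generateFrom
      (windowSets fun N => Finset.Icc (-N : ℤ) (-N + (2 * N : ℕ))) := by
  apply le_antisymm
  · rw [← iSup_comap_coordReal_eq (S := fun _ => True) fun j => by
      simp only [Finset.mem_Icc, true_iff]
      exact ⟨j.natAbs, by omega, by omega⟩]
    refine iSup_le fun j => ?_
    rintro _ ⟨B, hB, rfl⟩
    refine le_iSup₂ (f := fun j (_ : True) =>
      MeasurableSpace.comap (coordReal j) Real.measurableSpace) j trivial _
      ⟨Nat.cast '' (B : Set ℕ), ((Set.to_countable (B : Set ℕ)).image _).measurableSet, ?_⟩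
    ext y; simp [coordReal]
  · refine MeasurableSpace.generateFrom_le ?_
    rintro _ ⟨N, s, rfl⟩
    exact measurableSet_window _ _

theorem past_le (k : ℤ) : past coordReal k ≤ (MeasurableSpace.pi : MeasurableSpace (ℤ → ℕ)) :=
  iSup₂_le fun j _ => (measurable_coordReal j).comap_le

theorem future_le (k : ℤ) : future coordReal k ≤ (MeasurableSpace.pi : MeasurableSpace (ℤ → ℕ)) :=
  iSup₂_le fun j _ => (measurable_coordReal j).comap_le

theorem past_mono {j k : ℤ} (h : j ≤ k) : past coordReal j ≤ past coordReal k :=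
  iSup₂_le fun i hi => le_iSup₂ (f := fun j (_ : j ≤ k) =>
    MeasurableSpace.comap (coordReal j) Real.measurableSpace) i (hi.trans h)

theorem comap_coordReal_le_past {j k : ℤ} (h : j ≤ k) :
    MeasurableSpace.comap (coordReal j) Real.measurableSpace ≤ past coordReal k :=
  le_iSup₂ (f := fun j (_ : j ≤ k) =>
    MeasurableSpace.comap (coordReal j) Real.measurableSpace) j h

theorem comap_coordReal_le_future {j k : ℤ} (h : k ≤ j) :
    MeasurableSpace.comap (coordReal j) Real.measurableSpace ≤ future coordReal k :=
  le_iSup₂ (f := fun j (_ : k ≤ j) =>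
    MeasurableSpace.comap (coordReal j) Real.measurableSpace) j h

theorem measurableSet_comap_coordReal (k : ℤ) (B : Set ℕ) :
    MeasurableSet[MeasurableSpace.comap (coordReal k) Real.measurableSpace] {y | y k ∈ B} := by
  refine ⟨Nat.cast '' B, ((Set.to_countable B).image _).measurableSet, ?_⟩
  ext y; simp [coordReal]

theorem measurable_coord (k : ℤ) : Measurable fun y : ℤ → ℕ => y k := measurable_pi_apply k

theorem measurableSet_coord (k : ℤ) (B : Set ℕ) : MeasurableSet {y : ℤ → ℕ | y k ∈ B} :=
  measurable_pi_apply k (Set.to_countable B).measurableSet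

theorem setLIntegral_coord (ν : Measure (ℤ → ℕ)) (k : ℤ) (g : ℕ → ℝ≥0∞) (A : Set (ℤ → ℕ)) :
    ∫⁻ y in A, g (y k) ∂ν = ∑' a, g a * ν (A ∩ {y | y k = a}) := by
  rw [← lintegral_map (f := g) (measurable_of_countable g) (measurable_coord k),
    lintegral_countable']
  refine tsum_congr fun a => ?_
  rw [Measure.map_apply (measurable_coord k) (measurableSet_singleton a),
    Measure.restrict_apply (measurable_coord k (measurableSet_singleton a)), Set.inter_comm]
  rfl

theorem measure_eq_tsum_coord (ν : Measure (ℤ → ℕ)) (k : ℤ) (A : Set (ℤ → ℕ)) :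
    ν A = ∑' a, ν (A ∩ {y | y k = a}) := by
  have := setLIntegral_coord ν k (fun _ => 1) A
  simpa using this

section Chain

variable {p : PMF ℕ} {q : ℕ → PMF ℕ}

namespace IsChainLaw

variable {ν ν' : Measure (ℤ → ℕ)}

theorem unique [IsProbabilityMeasure ν] [IsProbabilityMeasure ν'] (h : IsChainLaw p q ν)
    (h' : IsChainLaw p q ν') : ν = ν' := by
  refine ext_of_generate_finite _ pi_eq_generateFrom_windowSets (isPiSystem_windowSets ?_) ?_
    (by simp)
  · intro N M hNM i
    simp only [Finset.mem_Icc]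
    omega
  · rintro _ ⟨N, s, rfl⟩
    rw [h, h']

theorem map_shift (h : IsChainLaw p q ν) (m : ℤ) :
    IsChainLaw p q (ν.map fun y k => y (k + m)) := by
  intro k n s
  rw [Measure.map_apply (by fun_prop) (measurableSet_window _ _)]
  have : (fun (y : ℤ → ℕ) k => y (k + m)) ⁻¹' {y | ∀ i ∈ Finset.Icc k (k + n), y i = s i} =
      {y | ∀ i ∈ Finset.Icc (k + m) (k + m + n), y i = s (i - m)} := by
    ext y
    simp only [Set.mem_preimage, Set.mem_ofPred_eq, Finset.mem_Icc]
    constructor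
    · intro hy i hi
      have := hy (i - m) (by omega)
      rwa [sub_add_cancel] at this
    · intro hy i hi
      have := hy (i + m) (by omega)
      rwa [add_sub_cancel_right] at this
  rw [this, h]
  rw [add_sub_cancel_right]
  congr 1
  refine Finset.prod_congr rfl fun i _ => ?_
  congr 2 <;> ring_nf

theorem map_neg (hrev : ∀ a b, p a * q a b = p b * q b a) (h : IsChainLaw p q ν) :
    IsChainLaw p q (ν.map fun y k => y (-k)) := by
  have key : ∀ (a : ℕ → ℕ) (n : ℕ), p (a n) * ∏ i ∈ Finset.range n, q (a (i + 1)) (a i) =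
      p (a 0) * ∏ i ∈ Finset.range n, q (a i) (a (i + 1)) := by
    intro a n
    induction n with
    | zero => simp
    | succ n ih =>
      rw [Finset.prod_range_succ, Finset.prod_range_succ, ← mul_assoc, ← mul_assoc, ← ih,
        mul_right_comm, hrev]
      ring
  intro k n s
  rw [Measure.map_apply (by fun_prop) (measurableSet_window _ _)]
  have : (fun (y : ℤ → ℕ) k => y (-k)) ⁻¹' {y | ∀ i ∈ Finset.Icc k (k + n), y i = s i} =
      {y | ∀ i ∈ Finset.Icc (-(k + n)) (-(k + n) + n), y i = s (-i)} := by
    ext y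
    simp only [Set.mem_preimage, Set.mem_ofPred_eq, Finset.mem_Icc]
    constructor
    · intro hy i hi
      have := hy (-i) (by omega)
      rwa [neg_neg] at this
    · intro hy i hi
      have := hy (-i) (by omega)
      rwa [neg_neg] at this
  rw [this, h, neg_neg]
  have key' := key (fun i => s (k + i)) n
  simp only [Nat.cast_zero, add_zero] at key'
  rw [← Finset.prod_range_reflect] at key'
  have e : ∀ i : ℕ, s (k + (i + 1 : ℕ)) = s (k + i + 1) := fun i => by
    congr 1; push_cast; ring
  simp only [e] at key'
  rw [← key']
  congr 1
  refine Finset.prod_congr rfl fun i hi => ?_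
  have := Finset.mem_range.1 hi
  congr 2 <;> (congr 1; omega)

theorem isStrictlyStationary [IsProbabilityMeasure ν] (h : IsChainLaw p q ν) :
    IsStrictlyStationary ν coordReal := by
  intro m
  have hs : Measurable fun (y : ℤ → ℕ) k => y (k + m) := by fun_prop
  have hc : Measurable fun (y : ℤ → ℕ) (k : ℤ) => (y k : ℝ) :=
    measurable_pi_lambda _ measurable_coordReal
  have := Measure.isProbabilityMeasure_map (μ := ν) hs.aemeasurable
  have := (h.map_shift m).unique h
  conv_rhs => rw [← this]
  exact (Measure.map_map hc hs).symm

theorem isReversible [IsProbabilityMeasure ν] (hrev : ∀ a b, p a * q a b = p b * q b a)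
    (h : IsChainLaw p q ν) : IsReversible ν coordReal := by
  have hs : Measurable fun (y : ℤ → ℕ) k => y (-k) := by fun_prop
  have hc : Measurable fun (y : ℤ → ℕ) (k : ℤ) => (y k : ℝ) :=
    measurable_pi_lambda _ measurable_coordReal
  have := Measure.isProbabilityMeasure_map (μ := ν) hs.aemeasurable
  have := (h.map_neg hrev).unique h
  unfold IsReversible
  conv_rhs => rw [← this]
  exact (Measure.map_map hc hs).symm

theorem measure_coord_eq (h : IsChainLaw p q ν) (k : ℤ) (a : ℕ) : ν {y | y k = a} = p a := by
  have := h k 0 fun _ => a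
  simpa using this

theorem measure_coord_inter_succ (h : IsChainLaw p q ν) (k : ℤ) (a b : ℕ) :
    ν ({y | y k = a} ∩ {y | y (k + 1) = b}) = p a * q a b := by
  have := h k 1 fun i => if i = k then a else b
  simp only [Finset.range_one, Finset.prod_singleton, Nat.cast_zero, add_zero, if_true,
    Nat.cast_one, add_eq_left, one_ne_zero, if_false] at this
  rw [← this]
  congr 1
  ext y
  simp only [Set.mem_inter_iff, Set.mem_ofPred_eq, Finset.mem_Icc]
  constructor
  · rintro ⟨h1, h2⟩ i hi
    rcases (by omega : i = k ∨ i = k + 1) with rfl | rfl <;> simp [h1, h2]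
  · intro hy
    exact ⟨by simpa using hy k (by omega), by simpa using hy (k + 1) (by omega)⟩

/-- Two windows which share exactly the time `k` are conditionally independent given the state at
time `k`. -/
theorem window_inter_window (h : IsChainLaw p q ν) (k : ℤ) (N M : ℕ) (s t : ℤ → ℕ)
    (hst : s k = t k) :
    ν ({y | ∀ i ∈ Finset.Icc (k - N) k, y i = s i} ∩ {y | ∀ i ∈ Finset.Icc k (k + M), y i = t i}) *
      p (t k) = ν {y | ∀ i ∈ Finset.Icc (k - N) k, y i = s i} *
        ν {y | ∀ i ∈ Finset.Icc k (k + M), y i = t i} := by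
  set w : ℤ → ℕ := fun i => if i ≤ k then s i else t i with hw
  have hws : ∀ i ≤ k, w i = s i := fun i hi => if_pos hi
  have hwt : ∀ i, k ≤ i → w i = t i := fun i hi => by
    rcases hi.eq_or_lt with rfl | hi
    · rw [hws _ le_rfl, hst]
    · exact if_neg (by omega)
  have h1 := h (k - N) N s
  have h3 := h (k - N) (N + M) w
  rw [sub_add_cancel] at h1
  have hset : {y : ℤ → ℕ | ∀ i ∈ Finset.Icc (k - N) k, y i = s i} ∩
      {y | ∀ i ∈ Finset.Icc k (k + M), y i = t i} =
      {y | ∀ i ∈ Finset.Icc (k - N) (k - N + (N + M : ℕ)), y i = w i} := by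
    ext y
    simp only [Set.mem_inter_iff, Set.mem_ofPred_eq, Finset.mem_Icc]
    constructor
    · rintro ⟨hy1, hy2⟩ i hi
      rcases le_total i k with hik | hik
      · rw [hws i hik, hy1 i (by omega)]
      · rw [hwt i hik, hy2 i (by push_cast at hi; omega)]
    · intro hy
      refine ⟨fun i hi => ?_, fun i hi => ?_⟩
      · rw [← hws i hi.2]; exact hy i (by push_cast; omega)
      · rw [← hwt i hi.1]; exact hy i (by push_cast; omega)
  rw [hset, h3, h1, h, Finset.prod_range_add, hws _ (by omega)]
  have e1 : ∏ i ∈ Finset.range N, q (w (k - N + i)) (w (k - N + i + 1)) =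
      ∏ i ∈ Finset.range N, q (s (k - N + i)) (s (k - N + i + 1)) := by
    refine Finset.prod_congr rfl fun i hi => ?_
    have := Finset.mem_range.1 hi
    rw [hws _ (by omega), hws _ (by omega)]
  have e2 : ∏ i ∈ Finset.range M, q (w (k - N + (N + i : ℕ))) (w (k - N + (N + i : ℕ) + 1)) =
      ∏ i ∈ Finset.range M, q (t (k + i)) (t (k + i + 1)) := by
    refine Finset.prod_congr rfl fun i hi => ?_
    have : k - N + ((N + i : ℕ) : ℤ) = k + i := by push_cast; ring
    rw [this, hwt _ (by omega), hwt _ (by omega)]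
  rw [e1, e2]
  ring

/-- Past and future are conditionally independent given the present state. -/
theorem condIndep [IsProbabilityMeasure ν] (h : IsChainLaw p q ν) (k : ℤ) (a : ℕ)
    {A B : Set (ℤ → ℕ)} (hA : MeasurableSet[past coordReal k] A)
    (hB : MeasurableSet[future coordReal k] B) :
    ν (A ∩ ({y | y k = a} ∩ B)) * p a = ν (A ∩ {y | y k = a}) * ν ({y | y k = a} ∩ B) := by
  have hk : MeasurableSet {y : ℤ → ℕ | y k = a} := measurableSet_coord k {a}
  -- first for an event of the future which fixes a window
  have step : ∀ (M : ℕ) (t : ℤ → ℕ) (A : Set (ℤ → ℕ)), MeasurableSet[past coordReal k] A →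
      ν (A ∩ ({y | y k = a} ∩ {y | ∀ i ∈ Finset.Icc k (k + M), y i = t i})) * p a =
        ν (A ∩ {y | y k = a}) *
          ν ({y | y k = a} ∩ {y | ∀ i ∈ Finset.Icc k (k + M), y i = t i}) := by
    intro M t A hA
    set W := {y : ℤ → ℕ | ∀ i ∈ Finset.Icc k (k + M), y i = t i} with hW
    have hmeas : MeasurableSet W := measurableSet_window _ _
    have : IsFiniteMeasure ((p a) • ν.restrict ({y | y k = a} ∩ W)) :=
      Measure.smul_finite _ (p.apply_ne_top a)
    have := ext_on_measurableSpace_of_generate_finite MeasurableSpace.pi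
      (μ := (p a) • ν.restrict ({y | y k = a} ∩ W))
      (ν := ν ({y | y k = a} ∩ W) • ν.restrict {y | y k = a}) (m := past coordReal k)
      _ ?_ (past_le k) (past_coordReal k) (isPiSystem_windowSets ?_) ?_ hA
    · rwa [Measure.smul_apply, Measure.smul_apply, Measure.restrict_apply (past_le k _ hA),
        Measure.restrict_apply (past_le k _ hA), smul_eq_mul, smul_eq_mul, mul_comm,
        mul_comm _ (ν (A ∩ _))] at this
    · rintro _ ⟨N, s, rfl⟩
      rw [Measure.smul_apply, Measure.smul_apply, Measure.restrict_apply (measurableSet_window _ _),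
        Measure.restrict_apply (measurableSet_window _ _), smul_eq_mul, smul_eq_mul]
      by_cases hta : t k = a
      · have e1 : {y | y k = a} ∩ W = W := Set.inter_eq_right.2 fun y hy => by
          simpa [hta] using hy k (by simp)
        by_cases hsa : s k = a
        · have e2 : {y | ∀ i ∈ Finset.Icc (k - N) k, y i = s i} ∩ {y | y k = a} =
              {y : ℤ → ℕ | ∀ i ∈ Finset.Icc (k - N) k, y i = s i} :=
            Set.inter_eq_left.2 fun y hy => by simpa [hsa] using hy k (by simp)
          have := h.window_inter_window k N M s t (hsa.trans hta.symm)
          rw [hta] at this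
          rw [e1, e2, mul_comm, this, mul_comm]
        · have e2 : {y | ∀ i ∈ Finset.Icc (k - N) k, y i = s i} ∩ {y : ℤ → ℕ | y k = a} = ∅ := by
            refine Set.eq_empty_of_forall_notMem fun y ⟨hy1, hy2⟩ => hsa ?_
            rw [← hy1 k (by simp)]; exact hy2
          rw [← Set.inter_assoc, e2]
          simp
      · have e1 : {y | y k = a} ∩ W = ∅ := by
          refine Set.eq_empty_of_forall_notMem fun y ⟨hy1, hy2⟩ => hta ?_
          rw [← hy2 k (by simp)]; exact hy1
        rw [e1]
        simp
    · intro N N' hN i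
      simp only [Finset.mem_Icc]
      omega
    · simp only [Measure.smul_apply, Measure.restrict_apply_univ, smul_eq_mul]
      rw [h.measure_coord_eq, mul_comm]
  have : IsFiniteMeasure ((p a) • ν.restrict (A ∩ {y | y k = a})) :=
    Measure.smul_finite _ (p.apply_ne_top a)
  have := ext_on_measurableSpace_of_generate_finite MeasurableSpace.pi
    (μ := (p a) • ν.restrict (A ∩ {y | y k = a}))
    (ν := ν (A ∩ {y | y k = a}) • ν.restrict {y | y k = a}) (m := future coordReal k)
    _ ?_ (future_le k) (future_coordReal k) (isPiSystem_windowSets ?_) ?_ hB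
  · rwa [Measure.smul_apply, Measure.smul_apply, Measure.restrict_apply (future_le k _ hB),
      Measure.restrict_apply (future_le k _ hB), smul_eq_mul, smul_eq_mul, mul_comm,
      Set.inter_comm B, Set.inter_comm B, Set.inter_assoc] at this
  · rintro _ ⟨M, t, rfl⟩
    rw [Measure.smul_apply, Measure.smul_apply, Measure.restrict_apply (measurableSet_window _ _),
      Measure.restrict_apply (measurableSet_window _ _), smul_eq_mul, smul_eq_mul, mul_comm]
    have := step M t A hA
    rwa [← Set.inter_assoc, Set.inter_comm (A ∩ _),
      Set.inter_comm {y : ℤ → ℕ | y k = a} {y | ∀ i ∈ _, _}] at this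
  · intro N N' hN i
    simp only [Finset.mem_Icc]
    omega
  · simp only [Measure.smul_apply, Measure.restrict_apply_univ, smul_eq_mul]
    rw [h.measure_coord_eq, mul_comm]

theorem measure_inter_coord_succ [IsProbabilityMeasure ν] (h : IsChainLaw p q ν)
    (hp : ∀ a, p a ≠ 0) (k : ℤ) (a : ℕ) (B : Set ℕ) {A : Set (ℤ → ℕ)}
    (hA : MeasurableSet[past coordReal k] A) :
    ν (A ∩ ({y | y k = a} ∩ {y | y (k + 1) ∈ B})) =
      ν (A ∩ {y | y k = a}) * (q a).toMeasure B := by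
  have h1 := h.condIndep k a hA
    (comap_coordReal_le_future (by omega : k ≤ k + 1) _ (measurableSet_comap_coordReal (k + 1) B))
  have h2 : (ν.restrict {y | y k = a}).map (fun y => y (k + 1)) = p a • (q a).toMeasure := by
    refine Measure.ext_of_singleton fun b => ?_
    rw [Measure.map_apply (measurable_coord (k + 1)) (measurableSet_singleton b),
      Measure.restrict_apply (measurable_coord (k + 1) (measurableSet_singleton b)),
      Measure.smul_apply, (q a).toMeasure_apply_singleton b (measurableSet_singleton b),
      smul_eq_mul, ← h.measure_coord_inter_succ k a b, Set.inter_comm]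
    rfl
  have hB := (Set.to_countable B).measurableSet
  have h3 : ν ({y | y k = a} ∩ {y | y (k + 1) ∈ B}) = p a * (q a).toMeasure B := by
    have := congrArg (fun m : Measure ℕ => m B) h2
    simp only [Measure.map_apply (measurable_coord (k + 1)) hB,
      Measure.restrict_apply (measurable_coord (k + 1) hB), Measure.smul_apply,
      smul_eq_mul] at this
    rw [← this, Set.inter_comm]
    rfl
  rw [h3, mul_comm (p a), ← mul_assoc] at h1
  exact (ENNReal.mul_left_inj (hp a) (p.apply_ne_top a)).1 h1

theorem condExp_coord_succ [IsProbabilityMeasure ν] (h : IsChainLaw p q ν) (hp : ∀ a, p a ≠ 0)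
    (k : ℤ) (B : Set ℕ) {m : MeasurableSpace (ℤ → ℕ)} (hm : m ≤ past coordReal k)
    (hm' : MeasurableSpace.comap (coordReal k) Real.measurableSpace ≤ m) :
    (fun y => (q (y k)).toMeasure.real B) =ᵐ[ν] ν⟦{y | y (k + 1) ∈ B} | m⟧ := by
  have hmeas : MeasurableSet[MeasurableSpace.pi] {y : ℤ → ℕ | y (k + 1) ∈ B} :=
    measurableSet_coord _ _
  have hint : Integrable (fun y : ℤ → ℕ => (q (y k)).toMeasure.real B) ν := by
    refine Integrable.of_bound (C := 1) ?_ (Eventually.of_forall fun y => ?_)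
    · exact ((measurable_of_countable fun a => (q a).toMeasure.real B).comp
        (measurable_coord k)).aestronglyMeasurable
    · rw [Real.norm_of_nonneg measureReal_nonneg]
      exact measureReal_le_one
  refine ae_eq_condExp_of_forall_setIntegral_eq (hm.trans (past_le k)) ?_
    (fun _ _ _ => hint.integrableOn) ?_ ?_
  · exact (integrable_const (1 : ℝ)).indicator hmeas
  · intro A hA _
    have hA' := hm _ hA
    rw [setIntegral_indicator hmeas, setIntegral_const, smul_eq_mul, mul_one]
    have e : ∫ y in A, (q (y k)).toMeasure.real B ∂ν =
        (∫⁻ y in A, (q (y k)).toMeasure B ∂ν).toReal :=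
      integral_toReal ((measurable_of_countable fun a => (q a).toMeasure B).comp
        (measurable_coord k)).aemeasurable (Eventually.of_forall fun y => measure_lt_top _ _)
    rw [e, setLIntegral_coord ν k (fun a => (q a).toMeasure B) A, Measure.real,
      measure_eq_tsum_coord ν k]
    congr 1
    refine tsum_congr fun a => ?_
    rw [mul_comm, ← h.measure_inter_coord_succ hp k a B hA', Set.inter_assoc,
      Set.inter_comm {y : ℤ → ℕ | y k = a}]
  · refine (Measurable.stronglyMeasurable ?_).aestronglyMeasurable
    intro D _
    exact hm' _ (measurableSet_comap_coordReal k {a | (q a).toMeasure.real B ∈ D})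

theorem isMarkovChain [IsProbabilityMeasure ν] (h : IsChainLaw p q ν) (hp : ∀ a, p a ≠ 0) :
    IsMarkovChain ν coordReal := by
  intro k B _
  have e : coordReal (k + 1) ⁻¹' B = {y | y (k + 1) ∈ {n : ℕ | (n : ℝ) ∈ B}} := rfl
  rw [e]
  exact (h.condExp_coord_succ hp k _ le_rfl (comap_coordReal_le_past le_rfl)).symm.trans
    (h.condExp_coord_succ hp k _ (comap_coordReal_le_past le_rfl) le_rfl)

end IsChainLaw

end Chain

/-! ### Spectral systems -/

theorem hasSum_of_forall_eq {f g : ℕ → ℝ} {S : ℝ} (h : ∀ i, f i = g i) (hg : HasSum g S) :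
    HasSum f S := by
  rwa [funext h]

/-- Fubini for an absolutely summable double series, in terms of sums of rows and columns. -/
theorem hasSum_swap {F : ℕ → ℕ → ℝ} {B b c d : ℕ → ℝ} {S : ℝ}
    (hF : ∀ i, HasSum (fun t => |F i t|) (B i)) (hB : ∀ i, B i ≤ b i) (hb : Summable b)
    (hc : ∀ i, HasSum (F i) (c i)) (hd : ∀ t, HasSum (fun i => F i t) (d t)) (hS : HasSum c S) :
    HasSum d S := by
  have h1 : Summable fun x : ℕ × ℕ => |F x.1 x.2| := by
    refine (summable_prod_of_nonneg fun _ => abs_nonneg _).2 ⟨fun i => (hF i).summable, ?_⟩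
    refine Summable.of_nonneg_of_le (fun i => tsum_nonneg fun _ => abs_nonneg _) (fun i => ?_) hb
    rw [(hF i).tsum_eq]
    exact hB i
  have h2 := (summable_abs_iff.1 h1).hasSum
  have h3 := h2.prod_fiberwise hc
  rw [h3.unique hS] at h2
  exact ((Equiv.prodComm ℕ ℕ).hasSum_iff.2 h2).prod_fiberwise hd

/-- Spectral data of a reversible transition kernel on `ℕ`: a stationary law `w` of full support,
bounded functions `φ i` which are orthonormal in `L²(w)`, and eigenvalues `lam i`. The `L¹(w)`-norms
`N i` of the `φ i` are square summable, so that the expansion of the kernel converges absolutely. -/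
structure IsSpectralSystem (w : ℕ → ℝ) (φ : ℕ → ℕ → ℝ) (lam N : ℕ → ℝ) : Prop where
  pos : ∀ s, 0 < w s
  zero_eq_one : ∀ s, φ 0 s = 1
  orthonormal : ∀ i j, HasSum (fun s => w s * (φ i s * φ j s)) (if i = j then 1 else 0)
  bounded : ∀ i, ∃ M, ∀ s, |φ i s| ≤ M
  hasSum_abs : ∀ i, HasSum (fun s => w s * |φ i s|) (N i)
  summable_sq : Summable fun i => N i ^ 2
  lam_zero : lam 0 = 1
  lam_mem : ∀ i, lam i ∈ Set.Icc (0 : ℝ) 1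
  kernel_nonneg : ∀ s t, 0 ≤ ∑' i, lam i * φ i s * φ i t

namespace IsSpectralSystem

variable {w : ℕ → ℝ} {φ : ℕ → ℕ → ℝ} {lam N : ℕ → ℝ} (hS : IsSpectralSystem w φ lam N)
include hS

theorem hasSum_weight : HasSum w 1 := by
  simpa [hS.zero_eq_one] using hS.orthonormal 0 0

theorem norm_nonneg (i : ℕ) : 0 ≤ N i :=
  (hS.hasSum_abs i).nonneg fun s => mul_nonneg (hS.pos s).le (abs_nonneg _)

theorem weight_mul_abs_le (i s : ℕ) : w s * |φ i s| ≤ N i :=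
  le_hasSum (hS.hasSum_abs i) s fun t _ => mul_nonneg (hS.pos t).le (abs_nonneg _)

theorem abs_le (i s : ℕ) : |φ i s| ≤ N i / w s := by
  rw [le_div_iff₀ (hS.pos s), mul_comm]
  exact hS.weight_mul_abs_le i s

theorem summable_kernel (s t : ℕ) : Summable fun i => lam i * φ i s * φ i t := by
  refine Summable.of_norm_bounded (g := fun i => N i ^ 2 * (1 / (w s * w t)))
    (hS.summable_sq.mul_right _) fun i => ?_
  rw [Real.norm_eq_abs, abs_mul, abs_mul, abs_of_nonneg (hS.lam_mem i).1]
  calc lam i * |φ i s| * |φ i t| ≤ 1 * (N i / w s) * (N i / w t) := by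
        have := hS.abs_le i s
        have := hS.abs_le i t
        have := (hS.lam_mem i).2
        have := (hS.pos s).le
        have := hS.norm_nonneg i
        gcongr
    _ = _ := by
        have := (hS.pos s).ne'
        have := (hS.pos t).ne'
        field_simp

/-- The transition kernel with eigenfunctions `φ i` and eigenvalues `lam i`. -/
@[nolint unusedArguments]
noncomputable def kernel (_ : IsSpectralSystem w φ lam N) (s t : ℕ) : ℝ :=
  w t * ∑' i, lam i * φ i s * φ i t

theorem kernel_nonneg' (s t : ℕ) : 0 ≤ hS.kernel s t :=
  mul_nonneg (hS.pos t).le (hS.kernel_nonneg s t)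

theorem hasSum_kernel (s t : ℕ) :
    HasSum (fun i => w t * (lam i * φ i s * φ i t)) (hS.kernel s t) :=
  (hS.summable_kernel s t).hasSum.mul_left _

theorem reversible (s t : ℕ) : w s * hS.kernel s t = w t * hS.kernel t s := by
  unfold kernel
  have : ∀ i, lam i * φ i s * φ i t = lam i * φ i t * φ i s := fun i => by ring
  simp_rw [this]
  ring

theorem hasSum_kernel_mul (s j : ℕ) :
    HasSum (fun t => hS.kernel s t * φ j t) (lam j * φ j s) := by
  obtain ⟨M, hM⟩ := hS.bounded j
  have hM0 : 0 ≤ M := (abs_nonneg _).trans (hM 0)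
  have hle : ∀ i t, |lam i * φ i s * (w t * (φ i t * φ j t))| ≤
      (|φ i s| * M) * (w t * |φ i t|) := by
    intro i t
    rw [abs_mul, abs_mul, abs_mul, abs_mul, abs_of_nonneg (hS.lam_mem i).1,
      abs_of_nonneg (hS.pos t).le]
    have h1 := (hS.lam_mem i).2
    have h2 := hM t
    have h3 := (hS.pos t).le
    calc lam i * |φ i s| * (w t * (|φ i t| * |φ j t|)) ≤
          1 * |φ i s| * (w t * (|φ i t| * M)) := by gcongr
      _ = _ := by ring
  have hsum : ∀ i, Summable fun t => |lam i * φ i s * (w t * (φ i t * φ j t))| := fun i =>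
    Summable.of_nonneg_of_le (fun _ => abs_nonneg _) (hle i) ((hS.hasSum_abs i).summable.mul_left _)
  refine hasSum_swap (F := fun i t => lam i * φ i s * (w t * (φ i t * φ j t)))
    (b := fun i => N i ^ 2 * (M / w s)) (c := fun i => lam i * φ i s * (if i = j then 1 else 0))
    (fun i => (hsum i).hasSum) (fun i => ?_) (hS.summable_sq.mul_right _)
    (fun i => (hS.orthonormal i j).mul_left _) (fun t => ?_) ?_
  · have h1 := hasSum_le (hle i) (hsum i).hasSum ((hS.hasSum_abs i).mul_left _)
    refine h1.trans ?_
    have := hS.abs_le i s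
    have := hS.norm_nonneg i
    calc |φ i s| * M * N i ≤ N i / w s * M * N i := by gcongr
      _ = _ := by ring
  · refine hasSum_of_forall_eq (fun i => ?_) ((hS.hasSum_kernel s t).mul_right (φ j t))
    ring
  · convert hasSum_ite_eq j (lam j * φ j s) using 2 with i
    split_ifs with h
    · rw [h, mul_one]
    · rw [mul_zero]

theorem hasSum_kernel_row (s : ℕ) : HasSum (hS.kernel s) 1 := by
  simpa [hS.zero_eq_one, hS.lam_zero] using hS.hasSum_kernel_mul s 0

end IsSpectralSystem

/-! ### Contrasts between a state and the smaller states -/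

/-- `G` is the distribution function of a probability law on `ℕ` that charges every point. -/
structure IsFullCdf (G : ℕ → ℝ) : Prop where
  zero_pos : 0 < G 0
  strictMono : StrictMono G
  tendsto : Tendsto G atTop (𝓝 1)

/-- The point masses of the law with distribution function `G`. -/
def pointMass (G : ℕ → ℝ) : ℕ → ℝ
  | 0 => G 0
  | l + 1 => G (l + 1) - G l

/-- The square of the constant which normalizes the contrast of the state `l + 1` with the states
`0, …, l` in `L²`. -/
noncomputable def contrastWeight (G : ℕ → ℝ) (l : ℕ) : ℝ := pointMass G (l + 1) * G l / G (l + 1)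

/-- The constant function `1`, followed by the normalized contrasts of the state `l + 1` with the
states `0, …, l`. -/
noncomputable def contrast (G : ℕ → ℝ) : ℕ → ℕ → ℝ
  | 0, _ => 1
  | l + 1, s => if s ≤ l then -(√(contrastWeight G l) / G l) else
      if s = l + 1 then √(contrastWeight G l) / pointMass G (l + 1) else 0

/-- The `L¹`-norms of the contrasts. -/
noncomputable def contrastNorm (G : ℕ → ℝ) : ℕ → ℝ
  | 0 => 1
  | l + 1 => 2 * √(contrastWeight G l)

theorem sum_pointMass (G : ℕ → ℝ) (l : ℕ) : ∑ s ∈ Finset.range (l + 1), pointMass G s = G l := by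
  induction l with
  | zero => simp [pointMass]
  | succ l ih => rw [Finset.sum_range_succ, ih, pointMass]; ring

theorem hasSum_pointMass_mul_step (G : ℕ → ℝ) (l : ℕ) (a b : ℝ) :
    HasSum (fun s => pointMass G s * (if s ≤ l then a else if s = l + 1 then b else 0))
      (G l * a + pointMass G (l + 1) * b) := by
  have h : HasSum (fun s => pointMass G s * (if s ≤ l then a else if s = l + 1 then b else 0))
      (∑ s ∈ Finset.range (l + 2),
        pointMass G s * (if s ≤ l then a else if s = l + 1 then b else 0)) :=
    hasSum_sum_of_ne_finset_zero fun s hs => by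
      have : l + 2 ≤ s := by simpa using hs
      rw [if_neg (by omega), if_neg (by omega), mul_zero]
  convert h using 1
  rw [Finset.sum_range_succ, if_neg (by omega), if_pos rfl]
  congr 1
  rw [← sum_pointMass G l, Finset.sum_mul]
  refine Finset.sum_congr rfl fun s hs => ?_
  rw [if_pos (by have := Finset.mem_range.1 hs; omega)]

theorem contrast_bounded (G : ℕ → ℝ) (i : ℕ) : ∃ M, ∀ s, |contrast G i s| ≤ M := by
  rcases i with _ | l
  · exact ⟨1, fun s => by simp [contrast]⟩
  · refine ⟨|√(contrastWeight G l) / G l| + |√(contrastWeight G l) / pointMass G (l + 1)|,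
      fun s => ?_⟩
    simp only [contrast]
    split_ifs
    · rw [abs_neg]; exact le_add_of_nonneg_right (abs_nonneg _)
    · exact le_add_of_nonneg_left (abs_nonneg _)
    · rw [abs_zero]; positivity

namespace IsFullCdf

variable {G : ℕ → ℝ} (hG : IsFullCdf G)
include hG

theorem pos (l : ℕ) : 0 < G l := hG.zero_pos.trans_le (hG.strictMono.monotone (Nat.zero_le l))

theorem lt_one (l : ℕ) : G l < 1 :=
  (hG.strictMono l.lt_succ_self).trans_le (hG.strictMono.monotone.ge_of_tendsto hG.tendsto _)

theorem pointMass_pos (s : ℕ) : 0 < pointMass G s := by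
  cases s with
  | zero => exact hG.zero_pos
  | succ l => exact sub_pos.2 (hG.strictMono l.lt_succ_self)

theorem hasSum_pointMass : HasSum (pointMass G) 1 := by
  rw [hasSum_iff_tendsto_nat_of_nonneg fun s => (hG.pointMass_pos s).le]
  rw [← tendsto_add_atTop_iff_nat 1]
  simp_rw [sum_pointMass]
  exact hG.tendsto

theorem contrastWeight_pos (l : ℕ) : 0 < contrastWeight G l :=
  div_pos (mul_pos (hG.pointMass_pos _) (hG.pos _)) (hG.pos _)

theorem contrastWeight_div_sq (l : ℕ) : contrastWeight G l / G l ^ 2 = (G l)⁻¹ - (G (l + 1))⁻¹ := by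
  have h1 := (hG.pos l).ne'
  have h2 := (hG.pos (l + 1)).ne'
  simp only [contrastWeight, pointMass]
  field_simp

theorem contrastWeight_le (l : ℕ) : contrastWeight G l ≤ G l * (1 - G l) := by
  have h1 := hG.pos l
  have h2 := hG.pos (l + 1)
  have h3 := hG.lt_one (l + 1)
  have h4 := hG.lt_one l
  rw [contrastWeight, pointMass, div_le_iff₀ h2]
  nlinarith [mul_nonneg h1.le (mul_nonneg h1.le (sub_nonneg.2 h3.le))]

theorem contrast_orthonormal (i j : ℕ) :
    HasSum (fun s => pointMass G s * (contrast G i s * contrast G j s))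
      (if i = j then 1 else 0) := by
  have hzero : ∀ l, HasSum (fun s => pointMass G s * contrast G (l + 1) s) 0 := by
    intro l
    have := hasSum_pointMass_mul_step G l (-(√(contrastWeight G l) / G l))
      (√(contrastWeight G l) / pointMass G (l + 1))
    convert this using 1
    · rfl
    rw [mul_neg, mul_div_cancel₀ _ (hG.pos l).ne', mul_div_cancel₀ _ (hG.pointMass_pos _).ne']
    ring
  have hlt : ∀ l m, l < m → HasSum (fun s => pointMass G s *
      (contrast G (l + 1) s * contrast G (m + 1) s)) 0 := by
    intro l m hlm
    -- the contrast with the larger index is constant on the support of the other one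
    have := (hzero l).mul_left (-(√(contrastWeight G m) / G m))
    rw [mul_zero] at this
    refine hasSum_of_forall_eq (fun s => ?_) this
    rcases le_or_gt s m with h | h
    · have : contrast G (m + 1) s = -(√(contrastWeight G m) / G m) := by
        simp only [contrast, if_pos h]
      rw [this]; ring
    · have : contrast G (l + 1) s = 0 := by
        simp only [contrast]
        rw [if_neg (by omega), if_neg (by omega)]
      rw [this]; ring
  rcases i with _ | l <;> rcases j with _ | m
  · simpa [contrast] using hG.hasSum_pointMass
  · simpa [contrast] using hzero m
  · simpa [contrast] using hzero l
  · rcases lt_trichotomy l m with h | rfl | h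
    · rw [if_neg (by omega)]; exact hlt l m h
    · rw [if_pos rfl]
      have := hasSum_pointMass_mul_step G l ((√(contrastWeight G l) / G l) ^ 2)
        ((√(contrastWeight G l) / pointMass G (l + 1)) ^ 2)
      convert this using 1
      · funext s
        simp only [contrast]
        split_ifs <;> ring
      · have h1 := (hG.pos l).ne'
        have h2 := (hG.pos (l + 1)).ne'
        have h3 := (hG.pointMass_pos (l + 1)).ne'
        rw [div_pow, div_pow, Real.sq_sqrt (hG.contrastWeight_pos l).le, contrastWeight]
        field_simp
        simp only [pointMass]; ring
    · rw [if_neg (by omega)]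
      simpa only [mul_comm] using hlt m l h

theorem hasSum_abs_contrast (i : ℕ) :
    HasSum (fun s => pointMass G s * |contrast G i s|) (contrastNorm G i) := by
  rcases i with _ | l
  · simpa [contrast, contrastNorm] using hG.hasSum_pointMass
  · have := hasSum_pointMass_mul_step G l (√(contrastWeight G l) / G l)
      (√(contrastWeight G l) / pointMass G (l + 1))
    convert this using 1
    · funext s
      have h1 := div_nonneg (Real.sqrt_nonneg (contrastWeight G l)) (hG.pos l).le
      have h2 := div_nonneg (Real.sqrt_nonneg (contrastWeight G l)) (hG.pointMass_pos (l + 1)).le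
      simp only [contrast]
      split_ifs
      · rw [abs_neg, abs_of_nonneg h1]
      · rw [abs_of_nonneg h2]
      · rw [abs_zero]
    · rw [mul_div_cancel₀ _ (hG.pos l).ne', mul_div_cancel₀ _ (hG.pointMass_pos _).ne',
        contrastNorm]
      ring

theorem summable_contrastNorm_sq : Summable fun i => contrastNorm G i ^ 2 := by
  rw [← summable_nat_add_iff 1]
  refine Summable.of_nonneg_of_le (fun _ => sq_nonneg _) (fun l => ?_)
    (((summable_nat_add_iff 1).2 hG.hasSum_pointMass.summable).mul_left 4)
  rw [contrastNorm, mul_pow, Real.sq_sqrt (hG.contrastWeight_pos l).le, contrastWeight]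
  have : pointMass G (l + 1) * G l / G (l + 1) ≤ pointMass G (l + 1) := by
    rw [div_le_iff₀ (hG.pos _)]
    exact mul_le_mul_of_nonneg_left (hG.strictMono l.lt_succ_self).le (hG.pointMass_pos _).le
  linarith

/-- Nonnegativity of the kernel. Off the diagonal, at a pair of states with maximum `m + 1`, the
expansion is `1 - lam (m + 1) / G (m + 1)` plus a series which by monotonicity of `lam` dominates
`lam (m + 1)` times the telescoping series with sum `1 / G (m + 1) - 1`. -/
theorem contrast_kernel_nonneg {lam : ℕ → ℝ} (h0 : lam 0 = 1)
    (hlam : ∀ i, lam i ∈ Set.Icc (0 : ℝ) 1) (hmono : Monotone fun i => lam (i + 1)) (s t : ℕ)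
    (hsum : Summable fun i => lam i * contrast G i s * contrast G i t) :
    0 ≤ ∑' i, lam i * contrast G i s * contrast G i t := by
  wlog hst : s ≤ t generalizing s t
  · have := this t s (by simpa only [mul_right_comm] using hsum) (by omega)
    simpa only [mul_right_comm] using this
  rcases hst.eq_or_lt with rfl | hst
  · refine tsum_nonneg fun i => ?_
    rw [mul_assoc]
    exact mul_nonneg (hlam i).1 (mul_self_nonneg _)
  obtain ⟨m, rfl⟩ : ∃ m, t = m + 1 := ⟨t - 1, by omega⟩
  have hsm : s ≤ m := by omega
  set a : ℕ → ℝ := fun i => lam i * contrast G i s * contrast G i (m + 1) with ha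
  have ha0 : a 0 = 1 := by simp [ha, contrast, h0]
  have hamid : ∀ l < m, a (l + 1) = 0 := by
    intro l hl
    simp only [ha, contrast]
    rw [if_neg (by omega : ¬ m + 1 ≤ l), if_neg (by omega : ¬ m + 1 = l + 1), mul_zero]
  have ham : a (m + 1) = -(lam (m + 1) * (G (m + 1))⁻¹) := by
    simp only [ha, contrast]
    rw [if_pos hsm, if_neg (by omega : ¬ m + 1 ≤ m)]
    simp only [if_true]
    have h1 := (hG.pos m).ne'
    have h2 := (hG.pos (m + 1)).ne'
    have h3 := (hG.pointMass_pos (m + 1)).ne'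
    have h4 := Real.mul_self_sqrt (hG.contrastWeight_pos m).le
    calc _ = -(lam (m + 1) * ((√(contrastWeight G m) * √(contrastWeight G m)) /
          (G m * pointMass G (m + 1)))) := by field_simp
      _ = _ := by rw [h4, contrastWeight]; field_simp
  have hage : ∀ n, lam (m + 1) * ((G (m + 1 + n))⁻¹ - (G (m + 1 + n + 1))⁻¹) ≤ a (m + 2 + n) := by
    intro n
    have e : a (m + 2 + n) = lam (m + 2 + n) * ((G (m + 1 + n))⁻¹ - (G (m + 1 + n + 1))⁻¹) := by
      rw [show m + 2 + n = (m + 1 + n) + 1 by ring]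
      simp only [ha, contrast]
      rw [if_pos (by omega), if_pos (by omega), mul_assoc, neg_mul_neg, ← hG.contrastWeight_div_sq,
        div_mul_div_comm, Real.mul_self_sqrt (hG.contrastWeight_pos _).le, sq]
    rw [e]
    refine mul_le_mul_of_nonneg_right ?_ ?_
    · have := hmono (show m ≤ m + 1 + n by omega)
      simpa only [show m + 1 + n + 1 = m + 2 + n by ring] using this
    · rw [sub_nonneg]
      exact inv_anti₀ (hG.pos _) (hG.strictMono (Nat.lt_succ_self _)).le
  have hpart : ∀ n, 1 - lam (m + 1) * (G (m + 1 + n))⁻¹ ≤ ∑ i ∈ Finset.range (m + 2 + n), a i := by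
    intro n
    induction n with
    | zero =>
      rw [add_zero, add_zero, Finset.sum_range_succ, Finset.sum_range_succ', ha0, ham,
        Finset.sum_eq_zero fun l hl => hamid l (Finset.mem_range.1 hl)]
      linarith
    | succ n ih =>
      rw [← add_assoc (m + 2), Finset.sum_range_succ, ← add_assoc (m + 1)]
      have := hage n
      linarith
  have hlim1 : Tendsto (fun n => ∑ i ∈ Finset.range (m + 2 + n), a i) atTop (𝓝 (∑' i, a i)) := by
    have := (tendsto_add_atTop_iff_nat (m + 2)).2 hsum.hasSum.tendsto_sum_nat
    simpa only [add_comm] using this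
  have hlim2 : Tendsto (fun n => 1 - lam (m + 1) * (G (m + 1 + n))⁻¹) atTop
      (𝓝 (1 - lam (m + 1) * 1⁻¹)) := by
    have := (tendsto_add_atTop_iff_nat (m + 1)).2 hG.tendsto
    simp only [add_comm _ (m + 1)] at this
    exact tendsto_const_nhds.sub (tendsto_const_nhds.mul (this.inv₀ one_ne_zero))
  have := le_of_tendsto_of_tendsto' hlim2 hlim1 hpart
  have h1 := (hlam (m + 1)).2
  rw [inv_one, mul_one] at this
  linarith

theorem isSpectralSystem {lam : ℕ → ℝ} (h0 : lam 0 = 1)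
    (hlam : ∀ i, lam i ∈ Set.Icc (0 : ℝ) 1) (hmono : Monotone fun i => lam (i + 1)) :
    IsSpectralSystem (pointMass G) (contrast G) lam (contrastNorm G) := by
  have hle : ∀ i s, |contrast G i s| ≤ contrastNorm G i / pointMass G s := fun i s => by
    rw [le_div_iff₀ (hG.pointMass_pos s), mul_comm]
    exact le_hasSum (hG.hasSum_abs_contrast i) s
      fun t _ => mul_nonneg (hG.pointMass_pos t).le (abs_nonneg _)
  refine ⟨hG.pointMass_pos, fun s => rfl, hG.contrast_orthonormal, contrast_bounded G,
    hG.hasSum_abs_contrast, hG.summable_contrastNorm_sq, h0, hlam, fun s t =>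
    hG.contrast_kernel_nonneg h0 hlam hmono s t ?_⟩
  refine Summable.of_norm_bounded (g := fun i => contrastNorm G i ^ 2 *
    (1 / (pointMass G s * pointMass G t))) (hG.summable_contrastNorm_sq.mul_right _) fun i => ?_
  rw [Real.norm_eq_abs, abs_mul, abs_mul, abs_of_nonneg (hlam i).1]
  have h1 := hle i s
  have h2 := hle i t
  have h3 := (hlam i).2
  calc lam i * |contrast G i s| * |contrast G i t| ≤
        1 * (contrastNorm G i / pointMass G s) * (contrastNorm G i / pointMass G t) := by
        have := (abs_nonneg _).trans h1
        gcongr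
    _ = _ := by
        have := (hG.pointMass_pos s).ne'
        have := (hG.pointMass_pos t).ne'
        field_simp

/-- The inner products of the contrasts with the indicator of the states above `j`. -/
theorem hasSum_tail_contrast (i j : ℕ) :
    HasSum (fun s => pointMass G s * (if j < s then contrast G i s else 0))
      (if i = 0 then 1 - G j else if i ≤ j then 0 else
        √(contrastWeight G (i - 1)) * (G j / G (i - 1))) := by
  have hfull : HasSum (fun s => pointMass G s * contrast G i s) (if i = 0 then 1 else 0) := by
    simpa only [show ∀ s, contrast G 0 s = 1 from fun _ => rfl, mul_one] using
      hG.contrast_orthonormal i 0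
  have hhead : HasSum (fun s => pointMass G s * (if j < s then 0 else contrast G i s))
      (∑ s ∈ Finset.range (j + 1), pointMass G s * (if j < s then 0 else contrast G i s)) :=
    hasSum_sum_of_ne_finset_zero fun s hs => by
      have : j + 1 ≤ s := by simpa using hs
      rw [if_pos (by omega), mul_zero]
  have hsub := hfull.sub hhead
  have hval : (if i = 0 then 1 - G j else if i ≤ j then 0 else
      √(contrastWeight G (i - 1)) * (G j / G (i - 1))) = (if i = 0 then 1 else 0) -
      ∑ s ∈ Finset.range (j + 1), pointMass G s * (if j < s then 0 else contrast G i s) := by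
    have hs : ∑ s ∈ Finset.range (j + 1), pointMass G s * (if j < s then 0 else contrast G i s) =
        ∑ s ∈ Finset.range (j + 1), pointMass G s * contrast G i s :=
      Finset.sum_congr rfl fun s hs => by
        rw [if_neg (by have := Finset.mem_range.1 hs; omega)]
    rw [hs]
    rcases i with _ | l
    · simp [contrast, sum_pointMass]
    · rw [if_neg (Nat.succ_ne_zero l), if_neg (Nat.succ_ne_zero l), Nat.add_sub_cancel]
      split_ifs with h
      · have : HasSum (fun s => pointMass G s * contrast G (l + 1) s)
            (∑ s ∈ Finset.range (j + 1), pointMass G s * contrast G (l + 1) s) :=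
          hasSum_sum_of_ne_finset_zero fun s hs => by
            have : j + 1 ≤ s := by simpa using hs
            simp only [contrast]
            rw [if_neg (by omega), if_neg (by omega), mul_zero]
        rw [this.unique hfull, if_neg (Nat.succ_ne_zero l), sub_zero]
      · have : ∀ s ∈ Finset.range (j + 1), pointMass G s * contrast G (l + 1) s =
            pointMass G s * (-(√(contrastWeight G l) / G l)) := fun s hs => by
          simp only [contrast]
          rw [if_pos (by have := Finset.mem_range.1 hs; omega)]
        rw [Finset.sum_congr rfl this, ← Finset.sum_mul, sum_pointMass]
        ring
  rw [hval]
  refine hasSum_of_forall_eq (fun s => ?_) hsub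
  split_ifs <;> ring

end IsFullCdf

/-! ### Spectral expansion of the joint law of past and future -/

theorem hasSum_measureReal_coord (ν : Measure (ℤ → ℕ)) [IsFiniteMeasure ν] (k : ℤ)
    (A : Set (ℤ → ℕ)) : HasSum (fun a => ν.real (A ∩ {y | y k = a})) (ν.real A) := by
  have h := measure_eq_tsum_coord ν k A
  have hne : ∀ a, ν (A ∩ {y | y k = a}) ≠ ∞ := fun a => measure_ne_top _ _
  have := (ENNReal.summable_toReal (h ▸ measure_ne_top ν A)).hasSum
  rwa [← ENNReal.tsum_toReal_eq hne, ← h] at this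

theorem integrable_coord (ν : Measure (ℤ → ℕ)) [IsFiniteMeasure ν] (k : ℤ) {g : ℕ → ℝ}
    (hg : ∃ M, ∀ a, |g a| ≤ M) : Integrable (fun y => g (y k)) ν := by
  obtain ⟨M, hM⟩ := hg
  exact Integrable.of_bound
    ((measurable_of_countable g).comp (measurable_coord k)).aestronglyMeasurable M
    (Eventually.of_forall fun y => hM (y k))

theorem hasSum_setIntegral_coord (ν : Measure (ℤ → ℕ)) [IsFiniteMeasure ν] (k : ℤ) {g : ℕ → ℝ}
    (hg : ∃ M, ∀ a, |g a| ≤ M) (A : Set (ℤ → ℕ)) :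
    HasSum (fun a => ν.real (A ∩ {y | y k = a}) * g a) (∫ y in A, g (y k) ∂ν) := by
  have hmap : ∀ a, ((ν.restrict A).map fun y => y k).real {a} = ν.real (A ∩ {y | y k = a}) := by
    intro a
    rw [Measure.real, Measure.map_apply (measurable_coord k) (measurableSet_singleton a),
      Measure.restrict_apply (measurable_coord k (measurableSet_singleton a)), Set.inter_comm]
    rfl
  have hint : Integrable g ((ν.restrict A).map fun y => y k) :=
    (integrable_map_measure (measurable_of_countable g).aestronglyMeasurable
      (measurable_coord k).aemeasurable).2 (integrable_coord ν k hg).integrableOn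
  rw [← integral_map (f := g) (measurable_coord k).aemeasurable
    (measurable_of_countable g).aestronglyMeasurable, integral_countable hint]
  simp_rw [hmap, smul_eq_mul]
  obtain ⟨M, hM⟩ := hg
  refine (Summable.of_norm_bounded (g := fun a => ν.real (A ∩ {y | y k = a}) * M)
    ((hasSum_measureReal_coord ν k A).summable.mul_right M) fun a => ?_).hasSum
  rw [norm_mul, Real.norm_of_nonneg measureReal_nonneg]
  exact mul_le_mul_of_nonneg_left (hM a) measureReal_nonneg

/-- The probability mass function with real point masses `g`. -/
noncomputable def pmfOfHasSum (g : ℕ → ℝ) (h0 : ∀ a, 0 ≤ g a) (h1 : HasSum g 1) : PMF ℕ :=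
  ⟨fun a => ENNReal.ofReal (g a), by
    rw [ENNReal.summable.hasSum_iff, ← ENNReal.ofReal_tsum_of_nonneg h0 h1.summable, h1.tsum_eq,
      ENNReal.ofReal_one]⟩

theorem pmfOfHasSum_apply (g : ℕ → ℝ) (h0 : ∀ a, 0 ≤ g a) (h1 : HasSum g 1) (a : ℕ) :
    pmfOfHasSum g h0 h1 a = ENNReal.ofReal (g a) := rfl

namespace IsSpectralSystem

variable {w : ℕ → ℝ} {φ : ℕ → ℕ → ℝ} {lam N : ℕ → ℝ} (hS : IsSpectralSystem w φ lam N)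

section
include hS

theorem abs_bounded (i : ℕ) : ∃ M, ∀ s, |(|φ i s|)| ≤ M := by
  simpa only [abs_abs] using hS.bounded i

theorem abs_pow_mul_le (n i : ℕ) {x y : ℝ} (hx : |x| ≤ N i)
    (hy : |y| ≤ N i) : ‖lam i ^ n * x * y‖ ≤ N i ^ 2 := by
  rw [Real.norm_eq_abs, abs_mul, abs_mul, abs_pow, abs_of_nonneg (hS.lam_mem i).1, sq]
  have h1 := pow_le_one₀ (n := n) (hS.lam_mem i).1 (hS.lam_mem i).2
  have h2 := hS.norm_nonneg i
  calc lam i ^ n * |x| * |y| ≤ 1 * N i * N i := by gcongr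
    _ = _ := by ring

end

/-- The stationary law of a spectral system. -/
noncomputable def stationaryPMF : PMF ℕ :=
  pmfOfHasSum w (fun a => (hS.pos a).le) hS.hasSum_weight

/-- The transition probabilities of a spectral system. -/
noncomputable def kernelPMF (a : ℕ) : PMF ℕ :=
  pmfOfHasSum (hS.kernel a) (hS.kernel_nonneg' a) (hS.hasSum_kernel_row a)

theorem stationaryPMF_ne_zero (a : ℕ) : hS.stationaryPMF a ≠ 0 := by
  simpa [stationaryPMF, pmfOfHasSum_apply] using hS.pos a

theorem stationaryPMF_mul (a b : ℕ) :
    hS.stationaryPMF a * hS.kernelPMF a b = hS.stationaryPMF b * hS.kernelPMF b a := by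
  simp only [stationaryPMF, kernelPMF, pmfOfHasSum_apply]
  rw [← ENNReal.ofReal_mul (hS.pos a).le, ← ENNReal.ofReal_mul (hS.pos b).le, hS.reversible]

theorem real_coord_eq {hS : IsSpectralSystem w φ lam N} {ν : Measure (ℤ → ℕ)}
    (h : IsChainLaw hS.stationaryPMF hS.kernelPMF ν) (k : ℤ) (a : ℕ) :
    ν.real {y | y k = a} = w a := by
  rw [Measure.real, h.measure_coord_eq, stationaryPMF, pmfOfHasSum_apply,
    ENNReal.toReal_ofReal (hS.pos a).le]

theorem real_tail_inter {hS : IsSpectralSystem w φ lam N} {ν : Measure (ℤ → ℕ)}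
    (h : IsChainLaw hS.stationaryPMF hS.kernelPMF ν) (k : ℤ) (j a : ℕ) :
    ν.real ({y | y k ∈ Set.Ioi j} ∩ {y | y k = a}) =
      if j < a then w a else 0 := by
  split_ifs with hja
  · rw [← real_coord_eq h k a]
    congr 1
    refine Set.inter_eq_right.2 fun y hy => ?_
    rw [Set.mem_ofPred_eq] at hy ⊢
    rwa [hy]
  · rw [← measureReal_empty (μ := ν)]
    congr 1
    refine Set.eq_empty_of_forall_notMem fun y ⟨h1, h2⟩ => hja ?_
    rw [Set.mem_ofPred_eq] at h1 h2
    rwa [h2] at h1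

variable {hS} {ν : Measure (ℤ → ℕ)} [IsProbabilityMeasure ν]
  (h : IsChainLaw hS.stationaryPMF hS.kernelPMF ν)
include h

theorem real_inter_coord_succ (k : ℤ) (a b : ℕ) {A : Set (ℤ → ℕ)}
    (hA : MeasurableSet[past coordReal k] A) :
    ν.real (A ∩ {y | y (k + 1) = b} ∩ {y | y k = a}) =
      ν.real (A ∩ {y | y k = a}) * hS.kernel a b := by
  have := h.measure_inter_coord_succ hS.stationaryPMF_ne_zero k a {b} hA
  rw [(hS.kernelPMF a).toMeasure_apply_singleton b (measurableSet_singleton b), kernelPMF,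
    pmfOfHasSum_apply] at this
  rw [Set.inter_assoc, Set.inter_comm {y : ℤ → ℕ | y (k + 1) = b}]
  simp only [Set.mem_singleton_iff] at this
  rw [Measure.real, this, ENNReal.toReal_mul, ENNReal.toReal_ofReal (hS.kernel_nonneg' a b)]
  rfl

theorem hasSum_real_coord_succ (k : ℤ) (b : ℕ) {A : Set (ℤ → ℕ)}
    (hA : MeasurableSet[past coordReal k] A) :
    HasSum (fun a => ν.real (A ∩ {y | y k = a}) * hS.kernel a b)
      (ν.real (A ∩ {y | y (k + 1) = b})) :=
  hasSum_of_forall_eq (fun a => (real_inter_coord_succ h k a b hA).symm)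
    (hasSum_measureReal_coord ν k _)

theorem integral_coord_eq (k : ℤ) {g : ℕ → ℝ} (hg : ∃ M, ∀ a, |g a| ≤ M) {S : ℝ}
    (hgS : HasSum (fun a => w a * g a) S) : ∫ y, g (y k) ∂ν = S := by
  have := hasSum_setIntegral_coord ν k hg Set.univ
  simp_rw [Set.univ_inter, real_coord_eq h, setIntegral_univ] at this
  exact this.unique hgS

theorem integral_mul_eq (k : ℤ) (i j : ℕ) :
    ∫ y, φ i (y k) * φ j (y k) ∂ν = if i = j then 1 else 0 := by
  obtain ⟨M, hM⟩ := hS.bounded i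
  obtain ⟨M', hM'⟩ := hS.bounded j
  refine integral_coord_eq h k (g := fun a => φ i a * φ j a) ⟨M * M', fun a => ?_⟩
    (hS.orthonormal i j)
  rw [abs_mul]
  exact mul_le_mul (hM a) (hM' a) (abs_nonneg _) ((abs_nonneg _).trans (hM a))

theorem integral_abs_eq (k : ℤ) (i : ℕ) : ∫ y, |φ i (y k)| ∂ν = N i :=
  integral_coord_eq h k (g := fun a => |φ i a|) (hS.abs_bounded i) (hS.hasSum_abs i)

theorem setIntegral_abs_le (k : ℤ) (i : ℕ) (A : Set (ℤ → ℕ)) :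
    ∫ y in A, |φ i (y k)| ∂ν ≤ N i := by
  rw [← integral_abs_eq h k i]
  exact setIntegral_le_integral (integrable_coord ν k (hS.abs_bounded i))
    (Eventually.of_forall fun y => abs_nonneg _)

theorem abs_setIntegral_le (k : ℤ) (i : ℕ) (A : Set (ℤ → ℕ)) :
    |∫ y in A, φ i (y k) ∂ν| ≤ N i :=
  abs_integral_le_integral_abs.trans (setIntegral_abs_le h k i A)

/-- Along the chain, the integral of an eigenfunction over a past event is multiplied by the
eigenvalue at every step. -/
theorem setIntegral_succ (k : ℤ) (i : ℕ) {A : Set (ℤ → ℕ)}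
    (hA : MeasurableSet[past coordReal k] A) :
    ∫ y in A, φ i (y (k + 1)) ∂ν = lam i * ∫ y in A, φ i (y k) ∂ν := by
  obtain ⟨M, hM⟩ := hS.bounded i
  have hle : ∀ a b, |ν.real (A ∩ {y | y k = a}) * (hS.kernel a b * φ i b)| ≤
      ν.real (A ∩ {y | y k = a}) * (hS.kernel a b * M) := by
    intro a b
    rw [abs_mul, abs_mul, abs_of_nonneg measureReal_nonneg, abs_of_nonneg (hS.kernel_nonneg' a b)]
    exact mul_le_mul_of_nonneg_left (mul_le_mul_of_nonneg_left (hM b) (hS.kernel_nonneg' a b))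
      measureReal_nonneg
  have hrow : ∀ a, HasSum (fun b => ν.real (A ∩ {y | y k = a}) * (hS.kernel a b * M))
      (ν.real (A ∩ {y | y k = a}) * (1 * M)) := fun a =>
    ((hS.hasSum_kernel_row a).mul_right M).mul_left _
  have hsum : ∀ a, Summable fun b => |ν.real (A ∩ {y | y k = a}) * (hS.kernel a b * φ i b)| :=
    fun a => Summable.of_nonneg_of_le (fun _ => abs_nonneg _) (hle a) (hrow a).summable
  have key := hasSum_swap
    (F := fun a b => ν.real (A ∩ {y | y k = a}) * (hS.kernel a b * φ i b))
    (c := fun a => ν.real (A ∩ {y | y k = a}) * (lam i * φ i a))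
    (d := fun b => ν.real (A ∩ {y | y (k + 1) = b}) * φ i b)
    (S := lam i * ∫ y in A, φ i (y k) ∂ν) (fun a => (hsum a).hasSum)
    (fun a => hasSum_le (hle a) (hsum a).hasSum (hrow a))
    ((hasSum_measureReal_coord ν k A).summable.mul_right _)
    (fun a => (hS.hasSum_kernel_mul a i).mul_left _) (fun b => ?_) ?_
  · exact (hasSum_setIntegral_coord ν (k + 1) ⟨M, hM⟩ A).unique key
  · refine hasSum_of_forall_eq (fun a => ?_) ((hasSum_real_coord_succ h k b hA).mul_right (φ i b))
    ring
  · refine hasSum_of_forall_eq (fun a => ?_)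
      ((hasSum_setIntegral_coord ν k ⟨M, hM⟩ A).mul_left (lam i))
    ring

theorem setIntegral_add (k : ℤ) (n i : ℕ) {A : Set (ℤ → ℕ)}
    (hA : MeasurableSet[past coordReal k] A) :
    ∫ y in A, φ i (y (k + n)) ∂ν = lam i ^ n * ∫ y in A, φ i (y k) ∂ν := by
  induction n with
  | zero => simp
  | succ n ih =>
    have := setIntegral_succ h (k + n) i (past_mono (by omega) _ hA)
    rw [Nat.cast_succ, ← add_assoc, this, ih, pow_succ]
    ring

/-- Expansion of the joint law of a past event and the state at a later time. -/
theorem hasSum_real_coord_add (k : ℤ) (n : ℕ) (hn : 1 ≤ n) (t : ℕ) {A : Set (ℤ → ℕ)}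
    (hA : MeasurableSet[past coordReal k] A) :
    HasSum (fun i => lam i ^ n * (∫ y in A, φ i (y k) ∂ν) * (w t * φ i t))
      (ν.real (A ∩ {y | y (k + n) = t})) := by
  obtain ⟨m, rfl⟩ : ∃ m, n = m + 1 := ⟨n - 1, by omega⟩
  have hA' : MeasurableSet[past coordReal (k + m)] A := past_mono (by omega) _ hA
  have htN : ∀ i, |w t * φ i t| ≤ N i := fun i => by
    rw [abs_mul, abs_of_nonneg (hS.pos t).le]; exact hS.weight_mul_abs_le i t
  have habs : ∀ i, HasSum
      (fun a => |ν.real (A ∩ {y | y (k + m) = a}) * (w t * (lam i * φ i a * φ i t))|)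
      ((∫ y in A, |φ i (y (k + m))| ∂ν) * (lam i * |w t * φ i t|)) := fun i => by
    refine hasSum_of_forall_eq (fun a => ?_)
      ((hasSum_setIntegral_coord ν (k + m) (hS.abs_bounded i) A).mul_right _)
    simp only [abs_mul, abs_of_nonneg measureReal_nonneg, abs_of_nonneg (hS.lam_mem i).1]
    ring
  have hsum : Summable fun i =>
      lam i ^ (m + 1) * (∫ y in A, φ i (y k) ∂ν) * (w t * φ i t) :=
    Summable.of_norm_bounded hS.summable_sq fun i =>
      hS.abs_pow_mul_le _ i (abs_setIntegral_le h k i A) (htN i)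
  have hS' := hsum.hasSum
  have key := hasSum_swap
    (F := fun i a => ν.real (A ∩ {y | y (k + m) = a}) * (w t * (lam i * φ i a * φ i t)))
    (d := fun a => ν.real (A ∩ {y | y (k + m) = a}) * hS.kernel a t)
    habs (fun i => ?_) hS.summable_sq (fun i => ?_)
    (fun a => (hS.hasSum_kernel a t).mul_left _) hS'
  · have := key.unique (hasSum_real_coord_succ h (k + m) t hA')
    rw [this] at hS'
    rwa [Nat.cast_succ, ← add_assoc]
  · rw [sq]
    have h1 := setIntegral_abs_le h (k + m) i A
    have h2 : lam i * |w t * φ i t| ≤ 1 * N i :=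
      mul_le_mul (hS.lam_mem i).2 (htN i) (abs_nonneg _) zero_le_one
    rw [one_mul] at h2
    exact mul_le_mul h1 h2 (mul_nonneg (hS.lam_mem i).1 (abs_nonneg _)) (hS.norm_nonneg i)
  · have e : lam i ^ (m + 1) * (∫ y in A, φ i (y k) ∂ν) * (w t * φ i t) =
        (∫ y in A, φ i (y (k + m)) ∂ν) * (w t * lam i * φ i t) := by
      rw [setIntegral_add h k m i hA]; ring
    rw [e]
    refine hasSum_of_forall_eq (fun a => ?_)
      ((hasSum_setIntegral_coord ν (k + m) (hS.bounded i) A).mul_right _)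
    ring

/-- Expansion of the joint law of a past event and a future event. -/
theorem hasSum_real_inter (k : ℤ) (n : ℕ) (hn : 1 ≤ n) {A B : Set (ℤ → ℕ)}
    (hA : MeasurableSet[past coordReal k] A) (hB : MeasurableSet[future coordReal (k + n)] B) :
    HasSum (fun i => lam i ^ n * (∫ y in A, φ i (y k) ∂ν) * ∫ y in B, φ i (y (k + n)) ∂ν)
      (ν.real (A ∩ B)) := by
  have hA' : MeasurableSet[past coordReal (k + n)] A := past_mono (by omega) _ hA
  have hcond : ∀ t, ν.real (A ∩ B ∩ {y | y (k + n) = t}) * w t =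
      ν.real (A ∩ {y | y (k + n) = t}) * ν.real (B ∩ {y | y (k + n) = t}) := by
    intro t
    have := congrArg ENNReal.toReal (h.condIndep (k + n) t hA' hB)
    rw [ENNReal.toReal_mul, ENNReal.toReal_mul, stationaryPMF, pmfOfHasSum_apply,
      ENNReal.toReal_ofReal (hS.pos t).le, Set.inter_comm _ B, ← Set.inter_assoc] at this
    exact this
  have hsum : Summable fun i =>
      lam i ^ n * (∫ y in A, φ i (y k) ∂ν) * ∫ y in B, φ i (y (k + n)) ∂ν :=
    Summable.of_norm_bounded hS.summable_sq fun i =>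
      hS.abs_pow_mul_le _ i (abs_setIntegral_le h k i A) (abs_setIntegral_le h (k + n) i B)
  have hS' := hsum.hasSum
  have key := hasSum_swap
    (F := fun i t => lam i ^ n * (∫ y in A, φ i (y k) ∂ν) *
      (ν.real (B ∩ {y | y (k + n) = t}) * φ i t))
    (B := fun i => |lam i ^ n * (∫ y in A, φ i (y k) ∂ν)| * ∫ y in B, |φ i (y (k + n))| ∂ν)
    (d := fun t => ν.real (A ∩ B ∩ {y | y (k + n) = t}))
    (fun i => ?_) (fun i => ?_) hS.summable_sq
    (fun i => (hasSum_setIntegral_coord ν (k + n) (hS.bounded i) B).mul_left _) (fun t => ?_) hS'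
  · rwa [key.unique (hasSum_measureReal_coord ν (k + n) _)] at hS'
  · refine hasSum_of_forall_eq (fun t => ?_)
      ((hasSum_setIntegral_coord ν (k + n) (hS.abs_bounded i) B).mul_left _)
    rw [abs_mul _ (ν.real _ * _), abs_mul (ν.real _), abs_of_nonneg measureReal_nonneg]
  · have h1 : |∫ y in B, |φ i (y (k + n))| ∂ν| ≤ N i := by
      rw [abs_of_nonneg (integral_nonneg fun _ => abs_nonneg _)]
      exact setIntegral_abs_le h (k + n) i B
    have := hS.abs_pow_mul_le n i (abs_setIntegral_le h k i A) h1
    rw [norm_mul, Real.norm_eq_abs, Real.norm_of_nonneg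
      (integral_nonneg fun _ => abs_nonneg _)] at this
    exact this
  · have hw := (hS.pos t).ne'
    have h1 := (hasSum_real_coord_add h k n hn t hA).mul_right
      (ν.real (B ∩ {y | y (k + n) = t}) / w t)
    have e : ν.real (A ∩ B ∩ {y | y (k + n) = t}) =
        ν.real (A ∩ {y | y (k + n) = t}) * (ν.real (B ∩ {y | y (k + n) = t}) / w t) := by
      rw [← mul_div_assoc, ← hcond, mul_div_cancel_right₀ _ hw]
    rw [e]
    refine hasSum_of_forall_eq (fun i => ?_) h1
    field_simp

end IsSpectralSystem

/-! ### Maximal correlation of two σ-fields in diagonal position -/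

section Correlation

variable {Ω : Type*} {m0 : MeasurableSpace Ω} {P : Measure Ω}

theorem inner_toLp_toLp {f g : Ω → ℝ} (hf : MemLp f 2 P) (hg : MemLp g 2 P) :
    ⟪hf.toLp f, hg.toLp g⟫_ℝ = ∫ ω, f ω * g ω ∂P := by
  rw [L2.inner_def]
  refine integral_congr_ae ?_
  filter_upwards [hf.coeFn_toLp, hg.coeFn_toLp] with ω h1 h2
  rw [h1, h2]
  exact mul_comm _ _

/-- A closed subset of `L²` contains a function that is measurable for a sub-σ-field as soon as it
contains an additive class which contains the simple functions for that σ-field. -/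
theorem toLp_mem_of_dense [IsFiniteMeasure P] {m : MeasurableSpace Ω} (hm : m ≤ m0)
    {K : Set (Lp ℝ 2 P)} (hK : IsClosed K) (C : (Ω → ℝ) → Prop)
    (hind : ∀ (c : ℝ) (s : Set Ω), MeasurableSet[m] s → C (s.indicator fun _ => c))
    (hadd : ∀ f g, C f → C g → C (f + g)) (hsm : ∀ f, C f → StronglyMeasurable[m] f)
    (hmem : ∀ f (hf : MemLp f 2 P), C f → hf.toLp f ∈ K)
    {f : Ω → ℝ} (hfm : StronglyMeasurable[m] f) (hf : MemLp f 2 P) : hf.toLp f ∈ K := by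
  rw [← hK.closure_eq, EMetric.mem_closure_iff]
  intro ε hε
  have hf' : MemLp f 2 (P.trim hm) :=
    ⟨hfm.aestronglyMeasurable, by rw [eLpNorm_trim hm hfm]; exact hf.2⟩
  obtain ⟨δ, hδ0, hδ⟩ := exists_between hε
  obtain ⟨g, hg1, hg2⟩ := MemLp.induction_dense (by simp) C
    (fun c s hs _ η _ => ⟨s.indicator fun _ => c, by simp, hind c s hs⟩) hadd
    (fun g hg => (hsm g hg).aestronglyMeasurable) hf' hδ0.ne'
  have hgm := hsm g hg2
  rw [eLpNorm_trim hm (hfm.sub hgm)] at hg1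
  have hfg : MemLp (f - g) 2 P :=
    ⟨((hfm.sub hgm).mono hm).aestronglyMeasurable, hg1.trans_lt (hδ.trans_le le_top)⟩
  have hg : MemLp g 2 P := by simpa using hf.sub hfg
  exact ⟨hg.toLp g, hmem g hg hg2, by rw [Lp.edist_toLp_toLp]; exact hg1.trans_lt hδ⟩

/-- Suppose that the joint law of two σ-fields is diagonal with respect to two orthonormal systems
which begin with the constant function `1`, with diagonal entries at most `ρ` from the second one
on. Then, by Bessel's inequality and density of simple functions, all correlations are at most
`ρ`. -/
theorem abs_corr_le_of_hasSum [IsProbabilityMeasure P] {𝒜 ℬ : MeasurableSpace Ω} (h𝒜 : 𝒜 ≤ m0)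
    (hℬ : ℬ ≤ m0) {Φ Ψ : ℕ → Ω → ℝ} (hΦ : ∀ i, MemLp (Φ i) 2 P) (hΨ : ∀ i, MemLp (Ψ i) 2 P)
    (hΦo : ∀ i j, ∫ ω, Φ i ω * Φ j ω ∂P = if i = j then 1 else 0)
    (hΨo : ∀ i j, ∫ ω, Ψ i ω * Ψ j ω ∂P = if i = j then 1 else 0)
    (hΦ0 : ∀ ω, Φ 0 ω = 1) (hΨ0 : ∀ ω, Ψ 0 ω = 1) {c : ℕ → ℝ} {ρ : ℝ} (hρ : 0 ≤ ρ)
    (hc0 : c 0 = 1) (hc : ∀ i, |c (i + 1)| ≤ ρ)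
    (hAB : ∀ A B : Set Ω, MeasurableSet[𝒜] A → MeasurableSet[ℬ] B →
      HasSum (fun i => c i * (∫ ω in A, Φ i ω ∂P) * ∫ ω in B, Ψ i ω ∂P) (P.real (A ∩ B)))
    {Y Z : Ω → ℝ} (hYm : Measurable[𝒜] Y) (hZm : Measurable[ℬ] Z) (hY : MemLp Y 2 P)
    (hZ : MemLp Z 2 P) : |corr P Y Z| ≤ ρ := by
  have hint : ∀ {f g : Ω → ℝ}, MemLp f 2 P → MemLp g 2 P → Integrable (fun ω => f ω * g ω) P :=
    fun hf hg => hf.integrable_mul hg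
  have hconst : ∀ {m : MeasurableSpace Ω} (_ : m ≤ m0) (a : ℝ) {s : Set Ω},
      MeasurableSet[m] s → MemLp (s.indicator fun _ => a) 2 P := fun hm a s hs =>
    memLp_indicator_const 2 (hm _ hs) a (Or.inr (measure_ne_top _ _))
  -- simple functions, in the first argument
  set C : (Ω → ℝ) → Prop := fun f => StronglyMeasurable[𝒜] f ∧ MemLp f 2 P ∧
    ∀ B : Set Ω, MeasurableSet[ℬ] B →
      HasSum (fun i => c i * (∫ ω, f ω * Φ i ω ∂P) * ∫ ω in B, Ψ i ω ∂P) (∫ ω in B, f ω ∂P) with hC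
  have hCind : ∀ (a : ℝ) (s : Set Ω), MeasurableSet[𝒜] s → C (s.indicator fun _ => a) := by
    intro a s hs
    refine ⟨stronglyMeasurable_const.indicator hs, hconst h𝒜 a hs, fun B hB => ?_⟩
    have e1 : ∀ i, ∫ ω, s.indicator (fun _ => a) ω * Φ i ω ∂P = a * ∫ ω in s, Φ i ω ∂P := by
      intro i
      rw [← integral_const_mul, ← integral_indicator (h𝒜 _ hs)]
      congr 1; funext ω
      by_cases hω : ω ∈ s <;> simp [hω]
    have e2 : ∫ ω in B, s.indicator (fun _ => a) ω ∂P = a * P.real (s ∩ B) := by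
      rw [setIntegral_indicator (h𝒜 _ hs), setIntegral_const, smul_eq_mul, mul_comm,
        Set.inter_comm]
    rw [e2]
    refine hasSum_of_forall_eq (fun i => ?_) ((hAB s B hs hB).mul_left a)
    rw [e1]; ring
  have hCadd : ∀ f g, C f → C g → C (f + g) := by
    rintro f g ⟨hf1, hf2, hf3⟩ ⟨hg1, hg2, hg3⟩
    refine ⟨hf1.add hg1, hf2.add hg2, fun B hB => ?_⟩
    have e1 : ∀ i, ∫ ω, (f + g) ω * Φ i ω ∂P = ∫ ω, f ω * Φ i ω ∂P + ∫ ω, g ω * Φ i ω ∂P :=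
      fun i => by
        rw [← integral_add (hint hf2 (hΦ i)) (hint hg2 (hΦ i))]
        congr 1; funext ω; simp [add_mul]
    have e2 : ∫ ω in B, (f + g) ω ∂P = ∫ ω in B, f ω ∂P + ∫ ω in B, g ω ∂P :=
      integral_add (hf2.integrable one_le_two).integrableOn
        (hg2.integrable one_le_two).integrableOn
    rw [e2]
    refine hasSum_of_forall_eq (fun i => ?_) ((hf3 B hB).add (hg3 B hB))
    rw [e1]; ring
  -- simple functions, in the second argument
  set D : (Ω → ℝ) → (Ω → ℝ) → Prop := fun f g => StronglyMeasurable[ℬ] g ∧ MemLp g 2 P ∧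
    HasSum (fun i => c i * (∫ ω, f ω * Φ i ω ∂P) * ∫ ω, g ω * Ψ i ω ∂P) (∫ ω, f ω * g ω ∂P) with hD
  have hDind : ∀ f, C f → ∀ (a : ℝ) (s : Set Ω), MeasurableSet[ℬ] s →
      D f (s.indicator fun _ => a) := by
    rintro f ⟨hf1, hf2, hf3⟩ a s hs
    refine ⟨stronglyMeasurable_const.indicator hs, hconst hℬ a hs, ?_⟩
    have e1 : ∀ h : Ω → ℝ, ∫ ω, s.indicator (fun _ => a) ω * h ω ∂P = a * ∫ ω in s, h ω ∂P := by
      intro h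
      rw [← integral_const_mul, ← integral_indicator (hℬ _ hs)]
      congr 1; funext ω
      by_cases hω : ω ∈ s <;> simp [hω]
    have e2 : ∫ ω, f ω * s.indicator (fun _ => a) ω ∂P = a * ∫ ω in s, f ω ∂P := by
      rw [← e1]; congr 1; funext ω; ring
    rw [e2]
    refine hasSum_of_forall_eq (fun i => ?_) ((hf3 s hs).mul_left a)
    rw [e1]; ring
  have hDadd : ∀ f, C f → ∀ g h, D f g → D f h → D f (g + h) := by
    rintro f ⟨-, hf2, -⟩ g h ⟨hg1, hg2, hg3⟩ ⟨hh1, hh2, hh3⟩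
    refine ⟨hg1.add hh1, hg2.add hh2, ?_⟩
    have e1 : ∀ i, ∫ ω, (g + h) ω * Ψ i ω ∂P = ∫ ω, g ω * Ψ i ω ∂P + ∫ ω, h ω * Ψ i ω ∂P :=
      fun i => by
        rw [← integral_add (hint hg2 (hΨ i)) (hint hh2 (hΨ i))]
        congr 1; funext ω; simp [add_mul]
    have e2 : ∫ ω, f ω * (g + h) ω ∂P = ∫ ω, f ω * g ω ∂P + ∫ ω, f ω * h ω ∂P := by
      rw [← integral_add (hint hf2 hg2) (hint hf2 hh2)]
      congr 1; funext ω; simp [mul_add]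
    rw [e2]
    refine hasSum_of_forall_eq (fun i => ?_) (hg3.add hh3)
    rw [e1]; ring
  have horth : ∀ {Θ : ℕ → Ω → ℝ} (hΘ : ∀ i, MemLp (Θ i) 2 P),
      (∀ i j, ∫ ω, Θ i ω * Θ j ω ∂P = if i = j then 1 else 0) →
      Orthonormal ℝ fun i => (hΘ (i + 1)).toLp (Θ (i + 1)) := by
    intro Θ hΘ ho
    rw [orthonormal_iff_ite]
    intro i j
    rw [inner_toLp_toLp, ho]
    simp
  have h1mem : MemLp (fun _ : Ω => (1 : ℝ)) 2 P := memLp_const 1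
  set one : Lp ℝ 2 P := h1mem.toLp _ with hone
  have hbound : ∀ f g (hf : MemLp f 2 P) (hg : MemLp g 2 P), C f → D f g →
      |⟪hf.toLp f, hg.toLp g⟫_ℝ - ⟪one, hf.toLp f⟫_ℝ * ⟪one, hg.toLp g⟫_ℝ| ≤
        ρ * (‖hf.toLp f‖ * ‖hg.toLp g‖) := by
    rintro f g hf hg - ⟨-, -, hsum⟩
    rw [inner_toLp_toLp, hone, inner_toLp_toLp, inner_toLp_toLp]
    have h0 := (hasSum_nat_add_iff' 1).2 hsum
    simp only [Finset.range_one, Finset.sum_singleton, hc0, hΦ0, hΨ0, mul_one, one_mul] at h0 ⊢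
    refine le_of_tendsto h0.tendsto_sum_nat.abs (Eventually.of_forall fun n => ?_)
    have hfb := (horth hΦ hΦo).sum_inner_products_le (hf.toLp f) (s := Finset.range n)
    have hgb := (horth hΨ hΨo).sum_inner_products_le (hg.toLp g) (s := Finset.range n)
    simp only [inner_toLp_toLp] at hfb hgb
    calc |∑ i ∈ Finset.range n, c (i + 1) * (∫ ω, f ω * Φ (i + 1) ω ∂P) *
          ∫ ω, g ω * Ψ (i + 1) ω ∂P|
        ≤ ∑ i ∈ Finset.range n, ρ * (‖∫ ω, Φ (i + 1) ω * f ω ∂P‖ *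
          ‖∫ ω, Ψ (i + 1) ω * g ω ∂P‖) := by
          refine (Finset.abs_sum_le_sum_abs _ _).trans (Finset.sum_le_sum fun i _ => ?_)
          rw [abs_mul, abs_mul, mul_assoc]
          simp only [Real.norm_eq_abs, mul_comm (Φ _ _), mul_comm (Ψ _ _)]
          exact mul_le_mul_of_nonneg_right (hc i) (by positivity)
      _ ≤ ρ * (√(∑ i ∈ Finset.range n, ‖∫ ω, Φ (i + 1) ω * f ω ∂P‖ ^ 2) *
          √(∑ i ∈ Finset.range n, ‖∫ ω, Ψ (i + 1) ω * g ω ∂P‖ ^ 2)) := by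
          rw [← Finset.mul_sum]
          exact mul_le_mul_of_nonneg_left (Real.sum_mul_le_sqrt_mul_sqrt _ _ _) hρ
      _ ≤ ρ * (‖hf.toLp f‖ * ‖hg.toLp g‖) := by
          refine mul_le_mul_of_nonneg_left (mul_le_mul ?_ ?_ (Real.sqrt_nonneg _)
            (norm_nonneg _)) hρ
          · exact Real.sqrt_le_iff.2 ⟨norm_nonneg _, hfb⟩
          · exact Real.sqrt_le_iff.2 ⟨norm_nonneg _, hgb⟩
  have hbound' : ∀ f g (hf : MemLp f 2 P) (hg : MemLp g 2 P), C f → StronglyMeasurable[ℬ] g →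
      |⟪hf.toLp f, hg.toLp g⟫_ℝ - ⟪one, hf.toLp f⟫_ℝ * ⟪one, hg.toLp g⟫_ℝ| ≤
        ρ * (‖hf.toLp f‖ * ‖hg.toLp g‖) := by
    intro f g hf hg hCf hgm
    exact toLp_mem_of_dense hℬ (K := {z | |⟪hf.toLp f, z⟫_ℝ - ⟪one, hf.toLp f⟫_ℝ * ⟪one, z⟫_ℝ| ≤
      ρ * (‖hf.toLp f‖ * ‖z‖)}) (isClosed_le (by fun_prop) (by fun_prop)) (D f) (hDind f hCf)
      (hDadd f hCf) (fun g hg => hg.1) (fun g hg hDg => hbound f g hf hg hCf hDg) hgm hg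
  have hbound'' : ∀ f g (hf : MemLp f 2 P) (hg : MemLp g 2 P), StronglyMeasurable[𝒜] f →
      StronglyMeasurable[ℬ] g →
      |⟪hf.toLp f, hg.toLp g⟫_ℝ - ⟪one, hf.toLp f⟫_ℝ * ⟪one, hg.toLp g⟫_ℝ| ≤
        ρ * (‖hf.toLp f‖ * ‖hg.toLp g‖) := by
    intro f g hf hg hfm hgm
    exact toLp_mem_of_dense h𝒜 (K := {z | |⟪z, hg.toLp g⟫_ℝ - ⟪one, z⟫_ℝ * ⟪one, hg.toLp g⟫_ℝ| ≤
      ρ * (‖z‖ * ‖hg.toLp g‖)}) (isClosed_le (by fun_prop) (by fun_prop)) C hCind hCadd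
      (fun f hf => hf.1) (fun f hf hCf => hbound' f g hf hg hCf hgm) hfm hf
  -- centre the two variables
  have hYc : MemLp (fun ω => Y ω - P[Y]) 2 P := hY.sub (memLp_const _)
  have hZc : MemLp (fun ω => Z ω - P[Z]) 2 P := hZ.sub (memLp_const _)
  have hmean : ∀ {f : Ω → ℝ}, MemLp f 2 P → ∫ ω, (1 : ℝ) * (f ω - P[f]) ∂P = 0 := by
    intro f hf
    simp only [one_mul]
    rw [integral_sub (hf.integrable one_le_two) (integrable_const _)]
    simp
  have hnorm : ∀ {f : Ω → ℝ} (hf : MemLp f 2 P) (hfc : MemLp (fun ω => f ω - P[f]) 2 P),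
      ‖hfc.toLp _‖ = √Var[f; P] := by
    intro f hf hfc
    rw [norm_eq_sqrt_real_inner, inner_toLp_toLp, variance_eq_integral hf.aemeasurable]
    simp only [sq]
  have hmain := hbound'' _ _ hYc hZc
    (hYm.stronglyMeasurable.sub stronglyMeasurable_const)
    (hZm.stronglyMeasurable.sub stronglyMeasurable_const)
  rw [hnorm hY, hnorm hZ, hone, inner_toLp_toLp, inner_toLp_toLp, inner_toLp_toLp, hmean hY,
    zero_mul, sub_zero] at hmain
  rw [corr, abs_div, abs_of_nonneg (mul_nonneg (Real.sqrt_nonneg _) (Real.sqrt_nonneg _))]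
  exact div_le_of_le_mul₀ (by positivity) hρ hmain

end Correlation

/-! ### Bounds for the dependence coefficients -/

section Coefficients

variable {Ω : Type*} {m0 : MeasurableSpace Ω} {P : Measure Ω} [IsProbabilityMeasure P]
  {𝒜 ℬ : MeasurableSpace Ω}

theorem isFinPartition_pair {A : Set Ω} (hA : MeasurableSet[𝒜] A) :
    IsFinPartition 𝒜 ![A, Aᶜ] where
  measurableSet i := by fin_cases i; exacts [hA, hA.compl]
  disjoint i j hij := by
    fin_cases i <;> fin_cases j <;> first
      | exact absurd rfl hij
      | exact disjoint_compl_right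
      | exact disjoint_compl_left
  iUnion_eq := by
    refine Set.eq_univ_of_forall fun ω => ?_
    by_cases h : ω ∈ A
    · exact Set.mem_iUnion.2 ⟨0, h⟩
    · exact Set.mem_iUnion.2 ⟨1, h⟩

theorem abs_le_sum_pair (hℬ : ℬ ≤ m0) {A B : Set Ω} (hB : MeasurableSet[ℬ] B) :
    |P.real (A ∩ B) - P.real A * P.real B| ≤ (1 / 2) * ∑ i, ∑ j,
      |P.real (![A, Aᶜ] i ∩ ![B, Bᶜ] j) - P.real (![A, Aᶜ] i) * P.real (![B, Bᶜ] j)| := by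
  simp only [Fin.sum_univ_two, Matrix.cons_val_zero, Matrix.cons_val_one]
  have h1 : P.real (A ∩ Bᶜ) = P.real A - P.real (A ∩ B) := by
    rw [← measureReal_inter_add_sdiff (s := A) (hℬ _ hB), Set.sdiff_eq]; ring
  have h2 : P.real Bᶜ = 1 - P.real B := by rw [measureReal_compl (hℬ _ hB)]; simp
  have h3 : P.real (A ∩ Bᶜ) - P.real A * P.real Bᶜ =
      -(P.real (A ∩ B) - P.real A * P.real B) := by rw [h1, h2]; ring
  rw [h3, abs_neg]
  have h4 := abs_nonneg (P.real (Aᶜ ∩ B) - P.real Aᶜ * P.real B)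
  have h5 := abs_nonneg (P.real (Aᶜ ∩ Bᶜ) - P.real Aᶜ * P.real Bᶜ)
  linarith

/-- A bound for all the sums in the definition of `β` makes the suprema defining `α` and `β`
suprema of bounded sets, so that they dominate their members. -/
theorem alphaCoeff_betaCoeff_bounds (hℬ : ℬ ≤ m0) {b : ℝ}
    (hb : ∀ (I J : ℕ) (A : Fin I → Set Ω) (B : Fin J → Set Ω), IsFinPartition 𝒜 A →
      IsFinPartition ℬ B →
      (1 / 2) * ∑ i, ∑ j, |P.real (A i ∩ B j) - P.real (A i) * P.real (B j)| ≤ b) :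
    (∀ A B : Set Ω, MeasurableSet[𝒜] A → MeasurableSet[ℬ] B →
      |P.real (A ∩ B) - P.real A * P.real B| ≤ alphaCoeff P 𝒜 ℬ) ∧
    alphaCoeff P 𝒜 ℬ ≤ betaCoeff P 𝒜 ℬ ∧ betaCoeff P 𝒜 ℬ ≤ b := by
  have hbdd : BddAbove {x : ℝ | ∃ (I J : ℕ) (A : Fin I → Set Ω) (B : Fin J → Set Ω),
      IsFinPartition 𝒜 A ∧ IsFinPartition ℬ B ∧
      x = (1 / 2) * ∑ i, ∑ j, |P.real (A i ∩ B j) - P.real (A i) * P.real (B j)|} := by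
    refine ⟨b, ?_⟩
    rintro _ ⟨I, J, A, B, hA, hB, rfl⟩
    exact hb I J A B hA hB
  have hle : ∀ A B : Set Ω, MeasurableSet[𝒜] A → MeasurableSet[ℬ] B →
      |P.real (A ∩ B) - P.real A * P.real B| ≤ betaCoeff P 𝒜 ℬ := fun A B hA hB =>
    (abs_le_sum_pair hℬ hB).trans
      (le_csSup hbdd ⟨2, 2, _, _, isFinPartition_pair hA, isFinPartition_pair hB, rfl⟩)
  refine ⟨fun A B hA hB => le_csSup ⟨betaCoeff P 𝒜 ℬ, ?_⟩ ⟨A, B, hA, hB, rfl⟩, ?_, ?_⟩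
  · rintro _ ⟨A, B, hA, hB, rfl⟩
    exact hle A B hA hB
  · refine csSup_le ⟨_, ∅, ∅, @MeasurableSet.empty _ 𝒜, @MeasurableSet.empty _ ℬ, rfl⟩ ?_
    rintro _ ⟨A, B, hA, hB, rfl⟩
    exact hle A B hA hB
  · refine csSup_le ⟨_, 2, 2, _, _, isFinPartition_pair (@MeasurableSet.empty _ 𝒜),
      isFinPartition_pair (@MeasurableSet.empty _ ℬ), rfl⟩ ?_
    rintro _ ⟨I, J, A, B, hA, hB, rfl⟩
    exact hb I J A B hA hB

theorem cov_indicator {A B : Set Ω} (hA : MeasurableSet[m0] A) (hB : MeasurableSet[m0] B) :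
    cov[A.indicator (1 : Ω → ℝ), B.indicator (1 : Ω → ℝ); P] =
      P.real (A ∩ B) - P.real A * P.real B := by
  have hmem : ∀ {S : Set Ω}, MeasurableSet[m0] S → MemLp (S.indicator (1 : Ω → ℝ)) 2 P :=
    fun hS => memLp_indicator_const 2 hS 1 (Or.inr (measure_ne_top _ _))
  rw [covariance_eq_sub (hmem hA) (hmem hB), ← Set.inter_indicator_one, integral_indicator_one hA,
    integral_indicator_one hB, integral_indicator_one (hA.inter hB)]

/-- The correlation of the indicators of two events of equal probability bounds `ρ` from below. The
hypothesis `hρ` ensures that the supremum defining `ρ` is that of a bounded set. -/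
theorem le_rhoCoeff_of_event (h𝒜 : 𝒜 ≤ m0) (hℬ : ℬ ≤ m0) {ρ : ℝ}
    (hρ : ∀ Y Z : Ω → ℝ, Measurable[𝒜] Y → Measurable[ℬ] Z → MemLp Y 2 P → MemLp Z 2 P →
      |corr P Y Z| ≤ ρ) {A B : Set Ω} (hA : MeasurableSet[𝒜] A) (hB : MeasurableSet[ℬ] B) {t c : ℝ}
    (ht0 : 0 < t) (ht1 : t < 1) (hPA : P.real A = t) (hPB : P.real B = t)
    (hc : t ^ 2 + c * (t * (1 - t)) ≤ P.real (A ∩ B)) : c ≤ rhoCoeff P 𝒜 ℬ := by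
  have hpos : 0 < t * (1 - t) := mul_pos ht0 (sub_pos.2 ht1)
  have hvar : ∀ {S : Set Ω}, MeasurableSet[m0] S → P.real S = t →
      Var[S.indicator (1 : Ω → ℝ); P] = t * (1 - t) := by
    intro S hS hPS
    have hm : AEMeasurable (S.indicator (1 : Ω → ℝ)) P :=
      (memLp_indicator_const 2 hS 1 (Or.inr (measure_ne_top _ _))).aestronglyMeasurable.aemeasurable
    rw [← covariance_self hm, cov_indicator hS hS,
      Set.inter_self, hPS]
    ring
  have hcorr : c ≤ corr P (A.indicator (1 : Ω → ℝ)) (B.indicator (1 : Ω → ℝ)) := by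
    rw [corr, cov_indicator (h𝒜 _ hA) (hℬ _ hB), hvar (h𝒜 _ hA) hPA, hvar (hℬ _ hB) hPB,
      Real.mul_self_sqrt hpos.le, le_div_iff₀ hpos, hPA, hPB]
    linarith
  refine hcorr.trans ((le_abs_self _).trans (le_csSup ⟨ρ, ?_⟩ ⟨_, _, ?_, ?_, ?_, ?_, rfl⟩))
  · rintro _ ⟨Y, Z, hY, hZ, hY2, hZ2, rfl⟩
    exact hρ Y Z hY hZ hY2 hZ2
  · exact Measurable.indicator (m := 𝒜) measurable_const hA
  · exact Measurable.indicator (m := ℬ) measurable_const hB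
  · exact memLp_indicator_const 2 (h𝒜 _ hA) 1 (Or.inr (measure_ne_top _ _))
  · exact memLp_indicator_const 2 (hℬ _ hB) 1 (Or.inr (measure_ne_top _ _))

theorem rhoCoeff_le {ρ : ℝ} (hρ : ∀ Y Z : Ω → ℝ, Measurable[𝒜] Y → Measurable[ℬ] Z → MemLp Y 2 P →
      MemLp Z 2 P → |corr P Y Z| ≤ ρ) : rhoCoeff P 𝒜 ℬ ≤ ρ := by
  refine csSup_le ⟨_, fun _ => 0, fun _ => 0, measurable_const, measurable_const, memLp_const 0,
    memLp_const 0, rfl⟩ ?_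
  rintro _ ⟨Y, Z, hY, hZ, hY2, hZ2, rfl⟩
  exact hρ Y Z hY hZ hY2 hZ2

end Coefficients

namespace IsSpectralSystem

variable {w : ℕ → ℝ} {φ : ℕ → ℕ → ℝ} {lam N : ℕ → ℝ} {hS : IsSpectralSystem w φ lam N}
  {ν : Measure (ℤ → ℕ)} [IsProbabilityMeasure ν]
  (h : IsChainLaw hS.stationaryPMF hS.kernelPMF ν)
include h

theorem sum_setIntegral_abs (k : ℤ) (i : ℕ) {𝒜 : MeasurableSpace (ℤ → ℕ)}
    (h𝒜 : 𝒜 ≤ MeasurableSpace.pi) {I : ℕ} {A : Fin I → Set (ℤ → ℕ)} (hA : IsFinPartition 𝒜 A) :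
    ∑ a, ∫ y in A a, |φ i (y k)| ∂ν = N i := by
  rw [← integral_iUnion_fintype (fun a => h𝒜 _ (hA.measurableSet a)) hA.disjoint
    fun a => (integrable_coord ν k (hS.abs_bounded i)).integrableOn, hA.iUnion_eq,
    setIntegral_univ, integral_abs_eq h k i]

/-- The first term of the expansion of `ν (A ∩ B)` is `ν A * ν B`; the others are summed over the
partitions by the triangle inequality. -/
theorem sum_partition_le (n : ℕ) (hn : 1 ≤ n) {I J : ℕ} {A : Fin I → Set (ℤ → ℕ)}
    {B : Fin J → Set (ℤ → ℕ)} (hA : IsFinPartition (past coordReal 0) A)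
    (hB : IsFinPartition (future coordReal n) B) :
    ∑ a, ∑ b, |ν.real (A a ∩ B b) - ν.real (A a) * ν.real (B b)| ≤
      ∑' i, lam (i + 1) ^ n * N (i + 1) ^ 2 := by
  set IA : ℕ → Fin I → ℝ := fun i a => ∫ y in A a, |φ i (y 0)| ∂ν with hIA
  set IB : ℕ → Fin J → ℝ := fun i b => ∫ y in B b, |φ i (y n)| ∂ν with hIB
  have hIA0 : ∀ i a, 0 ≤ IA i a := fun i a => integral_nonneg fun _ => abs_nonneg _
  have hIB0 : ∀ i b, 0 ≤ IB i b := fun i b => integral_nonneg fun _ => abs_nonneg _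
  have hsum : ∀ a b, Summable fun i => lam (i + 1) ^ n * IA (i + 1) a * IB (i + 1) b := by
    intro a b
    refine Summable.of_norm_bounded ((summable_nat_add_iff 1).2 hS.summable_sq) fun i => ?_
    refine hS.abs_pow_mul_le n (i + 1) ?_ ?_
    · rw [abs_of_nonneg (hIA0 _ _)]; exact setIntegral_abs_le h 0 _ _
    · rw [abs_of_nonneg (hIB0 _ _)]; exact setIntegral_abs_le h n _ _
  have hle : ∀ a b, |ν.real (A a ∩ B b) - ν.real (A a) * ν.real (B b)| ≤
      ∑' i, lam (i + 1) ^ n * IA (i + 1) a * IB (i + 1) b := by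
    intro a b
    have h1 := hasSum_real_inter h 0 n hn (hA.measurableSet a)
      (B := B b) (by rw [zero_add]; exact hB.measurableSet b)
    have h2 := (hasSum_nat_add_iff' 1).2 h1
    simp only [Finset.range_one, Finset.sum_singleton, hS.zero_eq_one, hS.lam_zero, one_pow,
      one_mul, setIntegral_const, smul_eq_mul, mul_one, zero_add] at h2
    refine h2.norm_le_of_bounded (hsum a b).hasSum fun i => ?_
    rw [norm_mul, norm_mul, norm_pow, Real.norm_of_nonneg (hS.lam_mem _).1]
    have h3 : ‖∫ y in A a, φ (i + 1) (y 0) ∂ν‖ ≤ IA (i + 1) a := norm_integral_le_integral_norm _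
    have h4 : ‖∫ y in B b, φ (i + 1) (y n) ∂ν‖ ≤ IB (i + 1) b := norm_integral_le_integral_norm _
    have h5 := pow_nonneg (hS.lam_mem (i + 1)).1 n
    have h6 := hIA0 (i + 1) a
    gcongr
  have htot : HasSum (fun i => lam (i + 1) ^ n * N (i + 1) ^ 2)
      (∑ a, ∑ b, ∑' i, lam (i + 1) ^ n * IA (i + 1) a * IB (i + 1) b) := by
    refine hasSum_of_forall_eq (fun i => ?_)
      (hasSum_sum fun a _ => hasSum_sum fun b _ => (hsum a b).hasSum)
    rw [sq, ← mul_assoc]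
    nth_rewrite 1 [← sum_setIntegral_abs h 0 (i + 1) (past_le 0) hA]
    rw [← sum_setIntegral_abs h n (i + 1) (future_le n) hB, Finset.mul_sum]
    refine (Finset.sum_congr rfl fun b _ => ?_).trans Finset.sum_comm
    rw [Finset.mul_sum, Finset.sum_mul]
  rw [htot.tsum_eq]
  exact Finset.sum_le_sum fun a _ => Finset.sum_le_sum fun b _ => hle a b

theorem abs_corr_le (n : ℕ) (hn : 1 ≤ n) {r : ℝ} (hr : 0 ≤ r) (hlam : ∀ i, lam (i + 1) ≤ r)
    {Y Z : (ℤ → ℕ) → ℝ} (hYm : Measurable[past coordReal 0] Y)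
    (hZm : Measurable[future coordReal n] Z) (hY : MemLp Y 2 ν) (hZ : MemLp Z 2 ν) :
    |corr ν Y Z| ≤ r ^ n := by
  have hmem : ∀ (k : ℤ) (i : ℕ), MemLp (fun y => φ i (y k)) 2 ν := by
    intro k i
    obtain ⟨M, hM⟩ := hS.bounded i
    exact MemLp.of_bound ((measurable_of_countable (φ i)).comp
      (measurable_coord k)).aestronglyMeasurable M (Eventually.of_forall fun y => hM (y k))
  refine abs_corr_le_of_hasSum (past_le 0) (future_le n) (hmem 0) (hmem n) (integral_mul_eq h 0)
    (integral_mul_eq h n) (fun _ => hS.zero_eq_one _) (fun _ => hS.zero_eq_one _)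
    (c := fun i => lam i ^ n) (pow_nonneg hr n) (by simp [hS.lam_zero]) (fun i => ?_)
    (fun A B hA hB => ?_) hYm hZm hY hZ
  · rw [abs_of_nonneg (pow_nonneg (hS.lam_mem _).1 n)]
    exact pow_le_pow_left₀ (hS.lam_mem _).1 (hlam i) n
  · have := hasSum_real_inter h 0 n hn hA (B := B) (by rw [zero_add]; exact hB)
    simpa only [zero_add] using this

end IsSpectralSystem

namespace IsFullCdf

variable {G lam : ℕ → ℝ} (hG : IsFullCdf G)
  {hS : IsSpectralSystem (pointMass G) (contrast G) lam (contrastNorm G)}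
  {ν : Measure (ℤ → ℕ)} [IsProbabilityMeasure ν]
  (h : IsChainLaw hS.stationaryPMF hS.kernelPMF ν)
include hG h

theorem setIntegral_tail (k : ℤ) (i j : ℕ) : ∫ y in {y | y k ∈ Set.Ioi j}, contrast G i (y k) ∂ν =
    if i = 0 then 1 - G j else if i ≤ j then 0 else
      √(contrastWeight G (i - 1)) * (G j / G (i - 1)) := by
  refine (hasSum_setIntegral_coord ν k (contrast_bounded G i) _).unique
    (hasSum_of_forall_eq (fun a => ?_) (hG.hasSum_tail_contrast i j))
  rw [IsSpectralSystem.real_tail_inter h]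
  split_ifs <;> simp

theorem real_tail (k : ℤ) (j : ℕ) : ν.real {y | y k ∈ Set.Ioi j} = 1 - G j := by
  have := hG.setIntegral_tail h k 0 j
  simpa [contrast] using this

/-- The tail event `{j + 1, j + 2, …}` at times `0` and `n` is correlated at least as strongly as
the eigenvalue `lam (j + 1)` suggests: its contrast coefficients vanish for smaller indices, and
their squares sum to `G j * (1 - G j)`, telescopically. -/
theorem le_real_tail_inter (hmono : Monotone fun i => lam (i + 1)) (n j : ℕ) (hn : 1 ≤ n) :
    (1 - G j) ^ 2 + lam (j + 1) ^ n * ((1 - G j) * (1 - (1 - G j))) ≤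
      ν.real ({y | y 0 ∈ Set.Ioi j} ∩ {y | y n ∈ Set.Ioi j}) := by
  have hsum := IsSpectralSystem.hasSum_real_inter h 0 n hn
    (A := {y | y 0 ∈ Set.Ioi j}) (B := {y | y n ∈ Set.Ioi j})
    (comap_coordReal_le_past le_rfl _ (measurableSet_comap_coordReal 0 _))
    (comap_coordReal_le_future (by simp) _ (measurableSet_comap_coordReal n _))
  simp only [zero_add] at hsum
  simp_rw [hG.setIntegral_tail h] at hsum
  set a : ℕ → ℝ := fun i => if i = 0 then 1 - G j else if i ≤ j then 0 else
      √(contrastWeight G (i - 1)) * (G j / G (i - 1)) with ha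
  change HasSum (fun i => lam i ^ n * a i * a i) _ at hsum
  have ha0 : a 0 = 1 - G j := by simp [ha]
  have hamid : ∀ i < j, a (i + 1) = 0 := fun i hi => by
    simp only [ha]
    rw [if_neg (Nat.succ_ne_zero i), if_pos (by omega)]
  have hatail : ∀ m, lam (j + 1) ^ n * (G j ^ 2 * ((G (j + m))⁻¹ - (G (j + m + 1))⁻¹)) ≤
      lam (j + 1 + m) ^ n * a (j + 1 + m) * a (j + 1 + m) := by
    intro m
    have e : a (j + 1 + m) = √(contrastWeight G (j + m)) * (G j / G (j + m)) := by
      simp only [ha]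
      rw [if_neg (by omega), if_neg (by omega), show j + 1 + m - 1 = j + m by omega]
    have e2 : a (j + 1 + m) * a (j + 1 + m) =
        G j ^ 2 * ((G (j + m))⁻¹ - (G (j + m + 1))⁻¹) := by
      rw [e, mul_mul_mul_comm, Real.mul_self_sqrt (hG.contrastWeight_pos _).le,
        ← hG.contrastWeight_div_sq]
      ring
    rw [mul_assoc, e2]
    refine mul_le_mul_of_nonneg_right ?_ (by rw [← e2]; exact mul_self_nonneg _)
    refine pow_le_pow_left₀ (hS.lam_mem _).1 ?_ n
    have := hmono (show j ≤ j + m by omega)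
    simpa only [show j + m + 1 = j + 1 + m by ring] using this
  have hpart : ∀ m, (1 - G j) ^ 2 + lam (j + 1) ^ n * (G j ^ 2 * ((G j)⁻¹ - (G (j + m))⁻¹)) ≤
      ∑ i ∈ Finset.range (j + 1 + m), lam i ^ n * a i * a i := by
    intro m
    induction m with
    | zero =>
      rw [add_zero, add_zero, Finset.sum_range_succ', Finset.sum_eq_zero fun i hi => by
        rw [hamid i (Finset.mem_range.1 hi), mul_zero], ha0, hS.lam_zero]
      simp [sq]
    | succ m ih =>
      rw [← add_assoc (j + 1), Finset.sum_range_succ, ← add_assoc j]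
      have := hatail m
      linarith
  have hlim1 : Tendsto (fun m => ∑ i ∈ Finset.range (j + 1 + m), lam i ^ n * a i * a i) atTop
      (𝓝 (ν.real ({y | y 0 ∈ Set.Ioi j} ∩ {y | y n ∈ Set.Ioi j}))) := by
    have := (tendsto_add_atTop_iff_nat (j + 1)).2 hsum.tendsto_sum_nat
    simpa only [add_comm] using this
  have hlim2 : Tendsto (fun m => (1 - G j) ^ 2 +
      lam (j + 1) ^ n * (G j ^ 2 * ((G j)⁻¹ - (G (j + m))⁻¹))) atTop
      (𝓝 ((1 - G j) ^ 2 + lam (j + 1) ^ n * (G j ^ 2 * ((G j)⁻¹ - 1⁻¹)))) := by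
    have := (tendsto_add_atTop_iff_nat j).2 hG.tendsto
    simp only [add_comm _ j] at this
    exact tendsto_const_nhds.add (tendsto_const_nhds.mul (tendsto_const_nhds.mul
      (tendsto_const_nhds.sub (this.inv₀ one_ne_zero))))
  have hfin := le_of_tendsto_of_tendsto' hlim2 hlim1 hpart
  have hne := (hG.pos j).ne'
  have e : G j ^ 2 * ((G j)⁻¹ - 1⁻¹) = (1 - G j) * (1 - (1 - G j)) := by
    field_simp
    ring
  rwa [e] at hfin

end IsFullCdf

/-- The solution `G j ≥ 1 / 2` of `G j * (1 - G j) = C j / 2` increases to `1`. -/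
theorem isFullCdf_of_weights {C : ℕ → ℝ} (hC : C 0 ≤ 1 / 2)
    (hCanti : StrictAnti C) (hClim : Tendsto C atTop (𝓝 0)) :
    IsFullCdf fun j => (1 + √(1 - 2 * C j)) / 2 where
  zero_pos := by positivity
  strictMono i j hij := by
    have h1 := hCanti hij
    have h2 := hCanti.antitone (Nat.zero_le i)
    have := Real.sqrt_lt_sqrt (by linarith : 0 ≤ 1 - 2 * C i)
      (by linarith : 1 - 2 * C i < 1 - 2 * C j)
    simp only
    linarith
  tendsto := by
    have h1 : Tendsto (fun j => (1 + √(1 - 2 * C j)) / 2) atTop (𝓝 ((1 + √(1 - 2 * 0)) / 2)) :=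
      (((Real.continuous_sqrt.tendsto _).comp
        (tendsto_const_nhds.sub (hClim.const_mul 2))).const_add 1).div_const 2
    simpa using h1

end MixingRates

theorem theorem1p3 (r : ℝ) (hr0 : 0 < r) (hr1 : r ≤ 1)
    (f : ℝ → ℝ) (hf_range : ∀ x, 0 ≤ x → f x ∈ Set.Ioc (0 : ℝ) (1 / 2))
    (hf_cont : ContinuousOn f (Set.Ici 0)) (hf_anti : StrictAntiOn f (Set.Ici 0))
    (hf_lim : Tendsto f atTop (𝓝 0))
    (hf_slow : ∀ u ∈ Set.Ioo (0 : ℝ) 1, (fun x : ℝ => u ^ x) =o[atTop] f)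
    (hf_conv : ConvexOn ℝ (Set.Ici 0) (fun x => Real.log (f x))) :
    ∃ (Ω : Type) (_ : MeasurableSpace Ω) (P : Measure Ω) (X : ℤ → Ω → ℝ),
      IsProbabilityMeasure P ∧
      (∀ k, Measurable (X k)) ∧
      MixingRates.IsCountableState X ∧
      MixingRates.IsStrictlyStationary P X ∧
      MixingRates.IsMarkovChain P X ∧
      MixingRates.IsReversible P X ∧
      ∀ n : ℕ, 1 ≤ n →
        MixingRates.rhoMix P X n = r ^ n ∧
        (1 / 2) * r ^ n * f n ≤ MixingRates.alphaMix P X n ∧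
        MixingRates.alphaMix P X n ≤ MixingRates.betaMix P X n ∧
        MixingRates.betaMix P X n ≤ 12 * r ^ n * f n := by
  open MixingRates in
  obtain ⟨C, u, hC0, hC, hCanti, hu, humono, husup, hlow, hupp⟩ :=
    exists_exponential_envelope f hf_range hf_anti hf_lim hf_slow hf_conv
  have hClim : Tendsto C atTop (𝓝 0) := by
    refine (summable_of_sum_range_le (c := 8 * f (0 : ℕ)) (fun j => (hC0 j).le)
      fun N => ?_).tendsto_atTop_zero
    simpa using hupp 0 N
  -- `G` solves `G (1 - G) = C / 2`
  set G : ℕ → ℝ := fun j => (1 + √(1 - 2 * C j)) / 2 with hGdef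
  have hG : IsFullCdf G := isFullCdf_of_weights hC hCanti hClim
  have hGC : ∀ j, G j * (1 - G j) = C j / 2 := by
    intro j
    have h1 := Real.mul_self_sqrt (by linarith [hCanti.antitone (Nat.zero_le j)] :
      0 ≤ 1 - 2 * C j)
    simp only [hGdef]
    linear_combination -(1 / 4) * h1
  set lam : ℕ → ℝ := fun i => Nat.casesOn i 1 fun j => r * u j with hlam
  have hlam_le : ∀ j, lam (j + 1) ≤ r := fun j => mul_le_of_le_one_right hr0.le (hu j).2.le
  have hlam_mem : ∀ i, lam i ∈ Set.Icc (0 : ℝ) 1 := by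
    rintro (_ | j)
    · simp [hlam]
    · exact ⟨mul_nonneg hr0.le (hu j).1.le, (hlam_le j).trans hr1⟩
  have hmono : Monotone fun i => lam (i + 1) := fun i j hij =>
    mul_le_mul_of_nonneg_left (humono hij) hr0.le
  have hS := hG.isSpectralSystem (lam := lam) rfl hlam_mem hmono
  obtain ⟨ν, hν, h⟩ := exists_isChainLaw hS.stationaryPMF_mul
  refine ⟨ℤ → ℕ, inferInstance, ν, coordReal, hν, measurable_coordReal,
    ⟨Set.range Nat.cast, Set.countable_range _, fun k y => ⟨y k, rfl⟩⟩, h.isStrictlyStationary,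
    h.isMarkovChain hS.stationaryPMF_ne_zero, h.isReversible hS.stationaryPMF_mul,
    fun n hn => ?_⟩
  have hrn : 0 < r ^ n := pow_pos hr0 n
  have hfn : 0 < f n := (hf_range n (Nat.cast_nonneg n)).1
  have htail0 : ∀ j, MeasurableSet[past coordReal 0] {y | y 0 ∈ Set.Ioi j} := fun j =>
    comap_coordReal_le_past le_rfl _ (measurableSet_comap_coordReal 0 _)
  have htailn : ∀ j, MeasurableSet[future coordReal n] {y | y n ∈ Set.Ioi j} := fun j =>
    comap_coordReal_le_future le_rfl _ (measurableSet_comap_coordReal n _)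
  have hcorr : ∀ Y Z : (ℤ → ℕ) → ℝ, Measurable[past coordReal 0] Y →
      Measurable[future coordReal n] Z → MemLp Y 2 ν → MemLp Z 2 ν → |corr ν Y Z| ≤ r ^ n :=
    fun Y Z hYm hZm hY hZ => IsSpectralSystem.abs_corr_le h n hn hr0.le hlam_le hYm hZm hY hZ
  have hbeta : ∑' i, lam (i + 1) ^ n * contrastNorm G (i + 1) ^ 2 ≤ 2 * (8 * (r ^ n * f n)) := by
    refine Real.tsum_le_of_sum_range_le
      (fun i => mul_nonneg (pow_nonneg (hlam_mem (i + 1)).1 n) (sq_nonneg _)) fun N => ?_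
    have hterm : ∀ i, lam (i + 1) ^ n * contrastNorm G (i + 1) ^ 2 ≤
        2 * (r ^ n * (C i * u i ^ n)) := by
      intro i
      have h1 := (hG.contrastWeight_le i).trans_eq (hGC i)
      have h2 : (0 : ℝ) ≤ lam (i + 1) ^ n := pow_nonneg (hlam_mem (i + 1)).1 n
      have h3 : lam (i + 1) ^ n = r ^ n * u i ^ n := mul_pow r (u i) n
      have h4 : contrastNorm G (i + 1) ^ 2 = 2 ^ 2 * contrastWeight G i := by
        rw [contrastNorm, mul_pow, Real.sq_sqrt (hG.contrastWeight_pos i).le]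
      rw [h4]
      calc lam (i + 1) ^ n * (2 ^ 2 * contrastWeight G i) ≤
            lam (i + 1) ^ n * (2 ^ 2 * (C i / 2)) := by gcongr
        _ = _ := by rw [h3]; ring
    calc _ ≤ ∑ i ∈ Finset.range N, 2 * (r ^ n * (C i * u i ^ n)) :=
          Finset.sum_le_sum fun i _ => hterm i
      _ = 2 * (r ^ n * ∑ i ∈ Finset.range N, C i * u i ^ n) := by
          rw [Finset.mul_sum, Finset.mul_sum]
      _ ≤ 2 * (r ^ n * (8 * f n)) := by
          have := hupp n N
          gcongr
      _ = _ := by ring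
  obtain ⟨hα, hαβ, hβ⟩ := alphaCoeff_betaCoeff_bounds (P := ν) (𝒜 := past coordReal 0)
    (future_le n) (b := 8 * (r ^ n * f n)) fun I J A B hA hB => by
      have := IsSpectralSystem.sum_partition_le h n hn hA hB
      linarith
  refine ⟨le_antisymm (rhoCoeff_le hcorr) ?_, ?_, hαβ, hβ.trans ?_⟩
  · have hj : ∀ j, (r * u j) ^ n ≤ rhoMix ν coordReal n := fun j =>
      le_rhoCoeff_of_event (past_le 0) (future_le n) hcorr (htail0 j) (htailn j)
        (sub_pos.2 (hG.lt_one j)) (sub_lt_self _ (hG.pos j)) (hG.real_tail h 0 j)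
        (hG.real_tail h n j) (hG.le_real_tail_inter h hmono n j hn)
    have hlim : Tendsto (fun v : ℝ => (r * v) ^ n) (𝓝[<] 1) (𝓝 ((r * 1) ^ n)) :=
      ((continuous_const.mul continuous_id).pow n).continuousWithinAt
    rw [mul_one] at hlim
    refine le_of_tendsto hlim ?_
    filter_upwards [Ioo_mem_nhdsLT (zero_lt_one' ℝ)] with v hv
    obtain ⟨j, hvj⟩ := husup v hv.2
    refine le_trans ?_ (hj j)
    have := hv.1.le
    gcongr
  · obtain ⟨j, hj⟩ := hlow n
    have h1 := hG.le_real_tail_inter h hmono n j hn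
    have h2 := (le_abs_self _).trans (hα _ _ (htail0 j) (htailn j))
    rw [hG.real_tail h, hG.real_tail h] at h2
    have h3 : lam (j + 1) ^ n = r ^ n * u j ^ n := mul_pow r (u j) n
    have h4 : (1 - G j) * (1 - (1 - G j)) = C j / 2 := by rw [← hGC]; ring
    rw [h3, h4] at h1
    have h5 := mul_le_mul_of_nonneg_left hj hrn.le
    change _ ≤ alphaCoeff ν (past coordReal 0) (future coordReal n)
    linarith
  · have := mul_pos hrn hfn
    linarith
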